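/- Let $d\ge 1$ be an integer and let $\Lambda$ be a unimodular lattice of signature $(2d-1,10d-1)$, that is, a free abelian group of finite rank with a symmetric bilinear form $\Lambda\times\Lambda\to\mathbb Z$, $(x,y)\mapsto x\cdot y$, which induces an isomorphism $\Lambda\to\operatorname{Hom}(\Lambda,\mathbb Z)$ and whose real extension has signature $(2d-1,10d-1)$. (For example, $\Lambda=\Lambda_d:=H_2(M_d;\mathbb Z)$ with its intersection form, where $M_d$ is the total space of a generic, simply connected, genus one fibration $M_d\to\mathbb P^1$ of arithmetic genus $d$.) Let $\mathrm{O}(\Lambda)$ be the group of automorphisms of the abelian group $\Lambda$ that preserve the form, and call $U\in\mathrm{O}(\Lambda)$ unipotent if $U-1$ is a nilpotent endomorphism of $\Lambda$. Then every unipotent $U\in\mathrm{O}(\Lambda)$ fixes a primitive isotropic vector: there is $e\in\Lambda$ with $e\neq 0$, $e$ not of the form $nx$ with $x\in\Lambda$ and $n\in\mathbb Z\setminus\{1,-1\}$, such that $e\cdot e=0$ and $U(e)=e$. -/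

import Mathlib

open scoped TensorProduct

namespace IntegralLattice

variable {L : Type*} [AddCommGroup L]

/-- A symmetric bilinear form on a free abelian group of finite rank is unimodular if
`x ↦ B x` is an isomorphism from `L` onto its dual `Hom(L, ℤ)`. -/
def IsUnimodular (B : LinearMap.BilinForm ℤ L) : Prop :=
  Function.Bijective (fun x : L => (B x : L →ₗ[ℤ] ℤ))

/-- The real quadratic form `x ↦ B x x` on `ℝ ⊗ L`. -/
noncomputable def realForm (B : LinearMap.BilinForm ℤ L) : QuadraticForm ℝ (ℝ ⊗[ℤ] L) :=
  (LinearMap.BilinForm.baseChange ℝ B).toQuadraticMap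

/-- `B` has signature `(p, q)`: the maximal dimension of a positive (resp. negative) definite
subspace of `ℝ ⊗ L` is `p` (resp. `q`). -/
def HasSignature (B : LinearMap.BilinForm ℤ L) (p q : ℕ) : Prop :=
  sigPos (realForm B) = p ∧ sigNeg (realForm B) = q

/-- The orthogonal group of the lattice `(L, B)`, as a subgroup of `GL(L)`. -/
def orthogonalGroup (B : LinearMap.BilinForm ℤ L) : Subgroup (L ≃ₗ[ℤ] L) where
  carrier := {U | ∀ x y, B (U x) (U y) = B x y}
  one_mem' := fun _ _ => rfl
  mul_mem' := fun {U V} hU hV x y => by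
    change B (U (V x)) (U (V y)) = B x y
    rw [hU, hV]
  inv_mem' := fun {U} hU x y => by
    have h := hU (U.symm x) (U.symm y)
    rw [U.apply_symm_apply, U.apply_symm_apply] at h
    exact h.symm

/-- `U` is unipotent: `U - 1` is nilpotent. -/
def IsUnipotent (U : L ≃ₗ[ℤ] L) : Prop :=
  IsNilpotent ((U : Module.End ℤ L) - 1)

/-- A primitive (indivisible) vector: nonzero, and not a proper integral multiple. -/
def IsPrimitiveVector (e : L) : Prop :=
  e ≠ 0 ∧ ∀ (n : ℤ) (x : L), e = n • x → IsUnit n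

end IntegralLattice

/-!
If the unipotent isometry `U` is not the identity, put `N = U - 1` and let `N ^ k` be its last
nonzero power, `k ≥ 1`. Vectors in the image of `N ^ k` are fixed by `U`, and they are isotropic
because the image of `N` is orthogonal to its kernel (`exists_fixed_isotropic_of_ne_one`). If `U` is
the identity, what is needed is that an indefinite unimodular lattice contains a nonzero isotropic
vector (`IsUnimodular.exists_isotropic`).

This is derived from the structure of the Witt group of `ℚ`, as computed by Milnor and Tate, without
local-global principles. The Witt group of a field is defined by generators `[a]` and relations, and
a diagonal form is metabolic exactly when its class vanishes (`WittGroup.sum_cls_eq_zero` and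
`WittGroup.metabolicWeights_of_sum_cls_eq_zero`, both based on a cancellation property,
`DiagonalForm.IsMetabolic.cancel`). For every prime `p` there is a residue homomorphism to the Witt
group of `ZMod p`. If a class is represented by integers with prime factors at most `p`, the residue
at `p` is the only obstruction to getting rid of `p`: for integers `n` with all prime factors below
`p`, the class `[p n]` depends only on `n` modulo `p`, up to classes of integers with prime factors
below `p` (`WittGroup.cls_mul_sub_mem`). Hence a class all of whose residues vanish is a multiple of
`[1]`, the multiple being its signature (`WittGroup.eq_signature_smul_cls_one`).

The residues of a unimodular lattice vanish. At an odd prime `p` the lattice has an orthogonal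
family of full length whose norms are prime to `p` (`IsUnimodular.exists_orthogonal_not_dvd`), and at
`2` only the parity of the valuation of the discriminant counts. So a unimodular lattice of
signature `(p, q)` becomes metabolic over `ℚ` after adding `|p - q| < p + q` weights `±1`, and for
dimension reasons a Lagrangian of the sum meets the lattice.
-/

/-! ### Diagonal forms with a Lagrangian -/

namespace DiagonalForm

variable {F : Type*} [Field F] {ι κ : Type*} [Fintype ι] [Fintype κ]

/-- The diagonal form `∑ i, a i * x i * y i` is metabolic: it has a Lagrangian, that is, a subspace
equal to its own orthogonal complement. Zero weights are allowed; a Lagrangian then contains the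
radical, so that a zero weight counts for nothing. -/
def IsMetabolic (a : ι → F) : Prop :=
  ∃ W : Submodule F (ι → F), ∀ x, x ∈ W ↔ ∀ y ∈ W, ∑ i, a i * x i * y i = 0

theorem IsMetabolic.reindex (e : ι ≃ κ) {a : κ → F} (h : IsMetabolic a) :
    IsMetabolic (a ∘ e) := by
  obtain ⟨W, hW⟩ := h
  have key : ∀ x y : ι → F,
      ∑ i, (a ∘ e) i * x i * y i = ∑ k, a k * (x ∘ e.symm) k * (y ∘ e.symm) k := by
    intro x y
    rw [← e.sum_comp]
    simp
  refine ⟨W.comap (LinearMap.funLeft F F e.symm), fun x => ?_⟩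
  change x ∘ e.symm ∈ W ↔ ∀ y : ι → F, y ∘ e.symm ∈ W → _
  rw [hW]
  constructor
  · intro h y hy
    rw [key]
    exact h _ hy
  · intro h y hy
    have := h (y ∘ e) (by simpa [Function.comp_assoc] using hy)
    rw [key] at this
    simpa [Function.comp_assoc] using this

theorem IsMetabolic.sumElim {a : ι → F} {b : κ → F} (ha : IsMetabolic a) (hb : IsMetabolic b) :
    IsMetabolic (Sum.elim a b) := by
  obtain ⟨V, hV⟩ := ha
  obtain ⟨W, hW⟩ := hb
  refine ⟨V.comap (LinearMap.funLeft F F Sum.inl) ⊓ W.comap (LinearMap.funLeft F F Sum.inr),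
    fun x => ?_⟩
  change (x ∘ Sum.inl ∈ V ∧ x ∘ Sum.inr ∈ W) ↔
    ∀ y : ι ⊕ κ → F, (y ∘ Sum.inl ∈ V ∧ y ∘ Sum.inr ∈ W) → _
  constructor
  · rintro ⟨h1, h2⟩ y ⟨h3, h4⟩
    have e1 := (hV _).1 h1 _ h3
    have e2 := (hW _).1 h2 _ h4
    simp only [Function.comp_apply] at e1 e2
    simp [e1, e2]
  · intro h
    refine ⟨(hV _).2 fun y hy => ?_, (hW _).2 fun y hy => ?_⟩
    · simpa using h (Sum.elim y 0) ⟨by simpa using hy, by simp⟩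
    · simpa using h (Sum.elim 0 y) ⟨by simp, by simpa using hy⟩

/-- Cancellation: if `N` is a Lagrangian of `a` and `W` one of `a ⊕ b`, then the vectors `x` for
which some `n ∈ N` has `(n, x) ∈ W` form a Lagrangian of `b`. -/
theorem IsMetabolic.cancel {a : ι → F} {b : κ → F} (hab : IsMetabolic (Sum.elim a b))
    (ha : IsMetabolic a) : IsMetabolic b := by
  classical
  obtain ⟨N, hN⟩ := ha
  obtain ⟨W, hW⟩ := hab
  let T : Submodule F (ι ⊕ κ → F) := W ⊓ N.comap (LinearMap.funLeft F F Sum.inl)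
  refine ⟨T.map (LinearMap.funLeft F F Sum.inr), fun x => ⟨?_, fun hx => ?_⟩⟩
  · rintro ⟨z, ⟨hz, hzN⟩, rfl⟩ y ⟨w, ⟨hw, hwN⟩, rfl⟩
    have e1 := (hW _).1 hz _ hw
    have e2 := (hN _).1 hzN _ hwN
    simp only [LinearMap.funLeft_apply, Fintype.sum_sum_type, Sum.elim_inl, Sum.elim_inr]
      at e1 e2 ⊢
    rwa [e2, zero_add] at e1
  · -- It is enough that `(0, x)` lies in `W + (N ⊕ 0)`, which is seen by separating functionals.
    let N' : Submodule F (ι ⊕ κ → F) :=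
      N.comap (LinearMap.funLeft F F Sum.inl) ⊓ LinearMap.ker (LinearMap.funLeft F F Sum.inr)
    have hmem : Sum.elim (0 : ι → F) x ∈ W ⊔ N' := by
      by_contra hcon
      obtain ⟨f, hf, hker⟩ := Submodule.exists_le_ker_of_notMem hcon
      set c : ι ⊕ κ → F := Sum.elim a b with hc
      -- The functional vanishes on the radical, so it is represented by the vector `z`.
      let z : ι ⊕ κ → F := fun i => f (Pi.single i 1) / c i
      have hz : ∀ y, f y = ∑ i, c i * z i * y i := by
        intro y
        have : ∀ i, f (Pi.single i 1) = c i * z i := by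
          intro i
          by_cases hi : c i = 0
          · have : Pi.single i 1 ∈ W := by
              rw [hW]
              intro y _
              refine Finset.sum_eq_zero fun j _ => ?_
              by_cases hj : j = i
              · subst hj; simp [hi]
              · simp [Pi.single_eq_of_ne hj]
            have := hker (Submodule.mem_sup_left this)
            rw [LinearMap.mem_ker] at this
            simp [this, hi]
          · simp only [z]; field_simp
        conv_lhs => rw [← LinearMap.sum_single_apply (fun _ : ι ⊕ κ => F) y, map_sum]
        refine Finset.sum_congr rfl fun i _ => ?_
        rw [← this, mul_comm, ← smul_eq_mul, ← map_smul, ← Pi.single_smul,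
          smul_eq_mul, mul_one]
      have hzW : z ∈ W := by
        rw [hW]
        intro y hy
        rw [← hz]
        exact hker (Submodule.mem_sup_left hy)
      have hzN : z ∘ Sum.inl ∈ N := by
        rw [hN]
        intro y hy
        have h0 : Sum.elim y 0 ∈ N' := by
          refine ⟨?_, ?_⟩
          · change Sum.elim y (0 : κ → F) ∘ Sum.inl ∈ N
            simpa using hy
          · ext; simp [LinearMap.funLeft_apply]
        have := hker (Submodule.mem_sup_right h0)
        rw [LinearMap.mem_ker, hz] at this
        simpa [hc] using this
      apply hf
      rw [hz]
      have := hx (z ∘ Sum.inr) ⟨z, ⟨hzW, hzN⟩, rfl⟩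
      simp only [hc, Fintype.sum_sum_type, Sum.elim_inl, Sum.elim_inr, Pi.zero_apply, mul_zero,
        Finset.sum_const_zero, zero_add]
      rw [← this]
      exact Finset.sum_congr rfl fun i _ => by simp only [Function.comp_apply]; ring
    obtain ⟨w, hw, n, ⟨hn, hn0⟩, hwn⟩ := Submodule.mem_sup.1 hmem
    refine ⟨w, ⟨hw, ?_⟩, ?_⟩
    · change w ∘ Sum.inl ∈ N
      have : w ∘ Sum.inl = -(n ∘ Sum.inl) := by
        ext i
        have := congrFun hwn (Sum.inl i)
        simp only [Pi.add_apply, Sum.elim_inl, Pi.zero_apply] at this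
        simp only [Function.comp_apply, Pi.neg_apply]
        linear_combination this
      rw [this]
      exact N.neg_mem hn
    · ext i
      have h1 := congrFun hwn (Sum.inr i)
      have h2 := congrFun (LinearMap.mem_ker.1 hn0) i
      simp only [LinearMap.funLeft_apply, Pi.add_apply, Sum.elim_inr, Pi.zero_apply] at h1 h2 ⊢
      rwa [h2, add_zero] at h1

/-- If `b` is the pullback of `a` along a surjective linear map `P`, the graph of `P` makes
`a ⊕ -b` metabolic. -/
theorem isMetabolic_of_pullback {a : ι → F} {b : κ → F} (P : (κ → F) →ₗ[F] (ι → F))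
    (hP : Function.Surjective P)
    (h : ∀ y z, ∑ i, a i * P y i * P z i = ∑ j, b j * y j * z j) :
    IsMetabolic (Sum.elim a (-b)) := by
  classical
  let W : Submodule F (ι ⊕ κ → F) :=
    { carrier := {x | ∀ i, a i * (x (Sum.inl i) - P (x ∘ Sum.inr) i) = 0}
      zero_mem' := fun i => by
        have : (0 : ι ⊕ κ → F) ∘ Sum.inr = 0 := rfl
        simp [this]
      add_mem' := fun {x y} hx hy i => by
        have : (x + y) ∘ Sum.inr = x ∘ Sum.inr + y ∘ Sum.inr := rfl
        simp only [Set.mem_ofPred_eq] at hx hy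
        rw [this, map_add, Pi.add_apply, Pi.add_apply]
        linear_combination hx i + hy i
      smul_mem' := fun c x hx i => by
        have : (c • x) ∘ Sum.inr = c • (x ∘ Sum.inr) := rfl
        simp only [Set.mem_ofPred_eq] at hx
        rw [this, map_smul, Pi.smul_apply, Pi.smul_apply, smul_eq_mul, smul_eq_mul]
        linear_combination c * hx i }
  refine ⟨W, fun x => ⟨fun hx y hy => ?_, fun hx i => ?_⟩⟩
  · have e : ∀ i, a i * x (Sum.inl i) * y (Sum.inl i)
        = a i * P (x ∘ Sum.inr) i * P (y ∘ Sum.inr) i := by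
      intro i
      linear_combination y (Sum.inl i) * hx i + P (x ∘ Sum.inr) i * hy i
    simp only [Fintype.sum_sum_type, Sum.elim_inl, Sum.elim_inr, e, h, Function.comp_apply,
      Pi.neg_apply, neg_mul, Finset.sum_neg_distrib, add_neg_cancel]
  · obtain ⟨y, hy⟩ := hP (Pi.single i 1)
    have h1 := hx (Sum.elim (P y) y) (fun i => by simp)
    have h2 := h (x ∘ Sum.inr) y
    simp only [Fintype.sum_sum_type, Sum.elim_inl, Sum.elim_inr, Pi.neg_apply, neg_mul,
      Finset.sum_neg_distrib] at h1
    simp only [Function.comp_apply] at h2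
    rw [← h2, hy] at h1
    simp only [Pi.single_apply, mul_ite, mul_one, mul_zero, Finset.sum_ite_eq',
      Finset.mem_univ, if_true] at h1
    linear_combination h1

/-- A metabolic form `a ⊕ b` with more weights in `a` than in `b` has a Lagrangian too large to
miss the first summand, so `a` is isotropic. -/
theorem IsMetabolic.exists_isotropic {a : ι → F} {b : κ → F} (h : IsMetabolic (Sum.elim a b))
    (hcard : Fintype.card κ < Fintype.card ι) :
    ∃ x : ι → F, x ≠ 0 ∧ ∑ i, a i * x i * x i = 0 := by
  obtain ⟨W, hW⟩ := h
  by_contra! hcon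
  let r : W →ₗ[F] (κ → F) := (LinearMap.funLeft F F Sum.inr).comp W.subtype
  have hr : Function.Injective r := by
    rw [← LinearMap.ker_eq_bot, LinearMap.ker_eq_bot']
    rintro ⟨z, hz⟩ hz0
    have h2 : ∀ i, z (Sum.inr i) = 0 := fun i => congrFun hz0 i
    have h3 := (hW z).1 hz z hz
    simp only [Fintype.sum_sum_type, Sum.elim_inl, Sum.elim_inr, h2, mul_zero,
      Finset.sum_const_zero, add_zero] at h3
    have h4 : z ∘ Sum.inl = 0 := by
      by_contra h5
      exact hcon _ h5 h3
    ext i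
    rcases i with i | i
    · exact congrFun h4 i
    · exact h2 i
  have hle : Module.finrank F W ≤ Fintype.card κ := by
    simpa using LinearMap.finrank_le_finrank_of_injective hr
  let φ : (ι ⊕ κ → F) →ₗ[F] Module.Dual F W :=
    LinearMap.mk₂ F (fun x (y : W) => ∑ i, Sum.elim a b i * x i * y.1 i)
      (fun x x' y => by simp only [Pi.add_apply, mul_add, add_mul, Finset.sum_add_distrib])
      (fun c x y => by
        simp only [Pi.smul_apply, smul_eq_mul, Finset.mul_sum]
        exact Finset.sum_congr rfl fun i _ => by ring)
      (fun x y y' => by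
        simp only [Submodule.coe_add, Pi.add_apply, mul_add, Finset.sum_add_distrib])
      (fun c x y => by
        simp only [Submodule.coe_smul, Pi.smul_apply, smul_eq_mul, Finset.mul_sum]
        exact Finset.sum_congr rfl fun i _ => by ring)
  have hker : LinearMap.ker φ = W := by
    ext x
    rw [hW, LinearMap.mem_ker]
    constructor
    · intro hx y hy
      exact LinearMap.congr_fun hx ⟨y, hy⟩
    · intro hx
      ext y
      exact hx y.1 y.2
  have h1 := LinearMap.finrank_range_add_finrank_ker φ
  rw [hker, Module.finrank_fintype_fun_eq_card, Fintype.card_sum] at h1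
  have h2 := Submodule.finrank_le (LinearMap.range φ)
  rw [Subspace.dual_finrank_eq] at h2
  omega

end DiagonalForm

/-! ### Metabolic multisets of weights -/

namespace DiagonalForm

variable {F : Type*} [Field F] {ι κ : Type*} [Fintype ι] [Fintype κ]

theorem exists_equiv_of_map_univ_eq {α : Type*} {f : ι → α} {g : κ → α}
    (h : Finset.univ.val.map f = Finset.univ.val.map g) : ∃ e : ι ≃ κ, g ∘ e = f := by
  classical
  have hc : ∀ y, Fintype.card {i // f i = y} = Fintype.card {j // g j = y} := by
    intro y
    have h1 := congrArg (Multiset.count y) h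
    rw [Multiset.count_map, Multiset.count_map] at h1
    rw [Fintype.card_subtype, Fintype.card_subtype]
    simpa [Finset.card_def, eq_comm] using h1
  let e : ∀ y, {i // f i = y} ≃ {j // g j = y} := fun y => Fintype.equivOfCardEq (hc y)
  refine ⟨(Equiv.sigmaFiberEquiv f).symm.trans
    ((Equiv.sigmaCongrRight e).trans (Equiv.sigmaFiberEquiv g)), ?_⟩
  ext i
  exact (e (f i) ⟨i, rfl⟩).2

theorem map_univ_sumElim {α : Type*} (f : ι → α) (g : κ → α) :
    Finset.univ.val.map (Sum.elim f g) = Finset.univ.val.map f + Finset.univ.val.map g := by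
  rw [← Finset.univ_disjSum_univ, Finset.val_disjSum, Multiset.disjSum, Multiset.map_add,
    Multiset.map_map, Multiset.map_map]
  rfl

theorem pair_add_eq_cons_cons {α : Type*} (a b : α) (m : Multiset α) :
    ({a, b} : Multiset α) + m = a ::ₘ b ::ₘ m := by
  rw [Multiset.insert_eq_cons, Multiset.cons_add, Multiset.singleton_add]

theorem exists_map_univ_eq {α : Type*} (m : Multiset α) :
    ∃ (n : ℕ) (a : Fin n → α), Finset.univ.val.map a = m := by
  induction m using Quotient.inductionOn with
  | h l => exact ⟨l.length, l.get, by rw [Fin.univ_val_map, List.ofFn_get]; rfl⟩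

/-- The diagonal form with weights `m` is metabolic. -/
def MetabolicWeights (m : Multiset F) : Prop :=
  ∃ (n : ℕ) (a : Fin n → F), Finset.univ.val.map a = m ∧ IsMetabolic a

theorem metabolicWeights_map_iff {a : ι → F} :
    MetabolicWeights (Finset.univ.val.map a) ↔ IsMetabolic a := by
  constructor
  · rintro ⟨n, b, hb, hm⟩
    obtain ⟨e, he⟩ := exists_equiv_of_map_univ_eq hb.symm
    rw [← he]
    exact hm.reindex e
  · intro h
    refine ⟨Fintype.card ι, a ∘ (Fintype.equivFin ι).symm, ?_, h.reindex _⟩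
    rw [← Multiset.map_map]
    congr 1
    exact congrArg Finset.val (Finset.map_univ_equiv (Fintype.equivFin ι).symm)

namespace MetabolicWeights

theorem add {m k : Multiset F} (hm : MetabolicWeights m) (hk : MetabolicWeights k) :
    MetabolicWeights (m + k) := by
  obtain ⟨n, a, rfl, ha⟩ := hm
  obtain ⟨n', b, rfl, hb⟩ := hk
  rw [← map_univ_sumElim, metabolicWeights_map_iff]
  exact ha.sumElim hb

theorem cancel {m k : Multiset F} (hmk : MetabolicWeights (m + k)) (hm : MetabolicWeights m) :
    MetabolicWeights k := by
  obtain ⟨n, a, rfl, ha⟩ := hm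
  obtain ⟨n', b, rfl⟩ := exists_map_univ_eq k
  rw [← map_univ_sumElim, metabolicWeights_map_iff] at hmk
  exact metabolicWeights_map_iff.2 (hmk.cancel ha)

theorem of_pullback {a : ι → F} {b : κ → F} (P : (κ → F) →ₗ[F] (ι → F))
    (hP : Function.Surjective P)
    (h : ∀ y z, ∑ i, a i * P y i * P z i = ∑ j, b j * y j * z j) :
    MetabolicWeights
      (Finset.univ.val.map a + (Finset.univ.val.map b).map (fun c => -c)) := by
  have := metabolicWeights_map_iff.2 (isMetabolic_of_pullback P hP h)
  rw [map_univ_sumElim] at this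
  simpa [Multiset.map_map] using this

theorem add_neg (m : Multiset F) : MetabolicWeights (m + m.map (fun c => -c)) := by
  obtain ⟨n, a, rfl⟩ := exists_map_univ_eq m
  exact of_pullback LinearMap.id Function.surjective_id fun _ _ => rfl

theorem pair (c : F) : MetabolicWeights {c, -c} := by
  simpa using add_neg {c}

theorem singleton_zero : MetabolicWeights ({0} : Multiset F) :=
  ⟨1, fun _ => 0, by simp, ⊤, fun x => by simp⟩

end MetabolicWeights

end DiagonalForm

/-! ### The Witt group of a field by generators and relations -/

open DiagonalForm

/-- The relations of the Witt group, on the free abelian group generated by all elements of `F`;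
allowing `0` as a generator makes the last relation contain `[a] + [-a] = 0`. -/
def wittRelations (F : Type*) [Field F] : Set (FreeAbelianGroup F) :=
  {x | x = .of 0 ∨ (∃ a b, b ≠ 0 ∧ x = .of (a * b ^ 2) - .of a) ∨
    ∃ a b, x = .of a + .of b - .of (a + b) - .of (a * b * (a + b))}

/-- The Witt group of `F`, generated by the classes of the rank one forms `a * x ^ 2`. -/
abbrev WittGroup (F : Type*) [Field F] : Type _ :=
  FreeAbelianGroup F ⧸ AddSubgroup.closure (wittRelations F)

/-- A function on `F` satisfying the defining relations of the Witt group. -/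
structure IsWittMap {F A : Type*} [Field F] [AddCommGroup A] (φ : F → A) : Prop where
  zero : φ 0 = 0
  mul_sq : ∀ a b, b ≠ 0 → φ (a * b ^ 2) = φ a
  add : ∀ a b, φ a + φ b = φ (a + b) + φ (a * b * (a + b))

namespace WittGroup

variable {F : Type*} [Field F]

/-- The class of the rank one form `a * x ^ 2`. -/
def cls (a : F) : WittGroup F := QuotientAddGroup.mk (.of a)

theorem isWittMap_cls : IsWittMap (cls : F → WittGroup F) where
  zero := (QuotientAddGroup.eq_zero_iff _).2 (AddSubgroup.subset_closure (Or.inl rfl))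
  mul_sq a b hb := by
    have h : (QuotientAddGroup.mk (.of (a * b ^ 2) - .of a) : WittGroup F) = 0 :=
      (QuotientAddGroup.eq_zero_iff _).2
        (AddSubgroup.subset_closure (Or.inr (Or.inl ⟨a, b, hb, rfl⟩)))
    exact sub_eq_zero.1 h
  add a b := by
    have h : (QuotientAddGroup.mk
        (.of a + .of b - .of (a + b) - .of (a * b * (a + b))) : WittGroup F) = 0 :=
      (QuotientAddGroup.eq_zero_iff _).2
        (AddSubgroup.subset_closure (Or.inr (Or.inr ⟨a, b, rfl⟩)))
    rw [sub_sub] at h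
    exact sub_eq_zero.1 h

theorem cls_neg (a : F) : cls (-a) = -cls a := by
  have h := isWittMap_cls.add (-a) a
  rw [neg_add_cancel, mul_zero, isWittMap_cls.zero, add_zero] at h
  exact eq_neg_of_add_eq_zero_left h

/-- The homomorphism induced by a function that satisfies the Witt relations. -/
def lift {A : Type*} [AddCommGroup A] (φ : F → A) (h : IsWittMap φ) : WittGroup F →+ A :=
  QuotientAddGroup.lift _ (FreeAbelianGroup.lift φ) <| by
    rw [AddSubgroup.closure_le]
    rintro x (rfl | ⟨a, b, hb, rfl⟩ | ⟨a, b, rfl⟩)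
    · simp [h.zero]
    · simp [h.mul_sq a b hb]
    · simp [h.add a b]

@[simp]
theorem lift_cls {A : Type*} [AddCommGroup A] (φ : F → A) (h : IsWittMap φ) (a : F) :
    lift φ h (cls a) = φ a :=
  FreeAbelianGroup.lift_apply_of _ _

theorem induction_on {p : WittGroup F → Prop} (x : WittGroup F) (zero : p 0)
    (cls : ∀ a, p (cls a)) (neg : ∀ x, p x → p (-x)) (add : ∀ x y, p x → p y → p (x + y)) :
    p x := by
  induction x using QuotientAddGroup.induction_on with
  | H z =>
    induction z using FreeAbelianGroup.induction_on with
    | zero => exact zero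
    | of a => exact cls a
    | neg a h => exact neg _ h
    | add x y hx hy => exact add _ _ hx hy

/-- `m` and `k` have the same length and the same class, and their difference is metabolic. -/
def Related (m k : Multiset F) : Prop :=
  m.card = k.card ∧ (m.map cls).sum = (k.map cls).sum ∧ MetabolicWeights (m + k.map (fun c => -c))

namespace Related

theorem refl (m : Multiset F) : Related m m := ⟨rfl, rfl, .add_neg m⟩

theorem trans {m k l : Multiset F} (h : Related m k) (h' : Related k l) : Related m l := by
  refine ⟨h.1.trans h'.1, h.2.1.trans h'.2.1, ?_⟩
  have h1 := h.2.2.add h'.2.2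
  refine MetabolicWeights.cancel (m := k + k.map (fun c => -c)) ?_ (.add_neg k)
  convert h1 using 1
  abel

theorem add {m k m' k' : Multiset F} (h : Related m k) (h' : Related m' k') :
    Related (m + m') (k + k') := by
  refine ⟨by simp [h.1, h'.1], by simp [h.2.1, h'.2.1], ?_⟩
  convert h.2.2.add h'.2.2 using 1
  rw [Multiset.map_add]
  abel

theorem metabolicWeights {m k : Multiset F} (h : Related m k) (hm : MetabolicWeights m) :
    MetabolicWeights k := by
  have h1 := h.2.2.cancel hm
  refine MetabolicWeights.cancel (m := k.map (fun c => -c)) ?_ h1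
  rw [add_comm]
  exact .add_neg k

theorem mul_sq (a : F) {b : F} (hb : b ≠ 0) : Related {a} {a * b ^ 2} := by
  refine ⟨rfl, by simp [isWittMap_cls.mul_sq a b hb], ?_⟩
  have := MetabolicWeights.of_pullback (a := fun _ : Fin 1 => a) (b := fun _ : Fin 1 => a * b ^ 2)
    (b • LinearMap.id) (fun y => ⟨b⁻¹ • y, by simp [hb]⟩) (fun y z => by simp; ring)
  simpa using this

theorem pair {a b : F} (h : a + b ≠ 0) : Related {a, b} {a + b, a * b * (a + b)} := by
  refine ⟨rfl, by simpa using isWittMap_cls.add a b, ?_⟩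
  -- The vectors `(1, 1)` and `(-b, a)` form an orthogonal basis of the plane.
  have := MetabolicWeights.of_pullback (a := ![a, b]) (b := ![a + b, a * b * (a + b)])
    (Matrix.toLin' !![1, -b; 1, a])
    (fun y => ⟨![(a * y 0 + b * y 1) / (a + b), (y 1 - y 0) / (a + b)], by
      ext i
      fin_cases i <;> simp [Matrix.mulVec, dotProduct, Fin.sum_univ_two] <;> field_simp <;>
        ring⟩)
    (fun y z => by simp [Matrix.mulVec, dotProduct, Fin.sum_univ_two]; ring)
  rw [Fin.univ_val_map, Fin.univ_val_map] at this
  exact this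

end Related

/-- A partial sum `∑ i ∈ s, a i * x i ^ 2` with nonzero `x i` can be made one of the weights,
unless a hyperbolic plane `⟨c, -c⟩` is met on the way. -/
theorem exists_related_sum_cons {ι : Type*} (a x : ι → F) (s : Finset ι) (hs : s.Nonempty)
    (hx : ∀ i ∈ s, x i ≠ 0) :
    ∃ m, Related (s.val.map a) ((∑ i ∈ s, a i * x i ^ 2) ::ₘ m) ∨
      ∃ c, Related (s.val.map a) (c ::ₘ -c ::ₘ m) := by
  induction hs using Finset.Nonempty.cons_induction with
  | singleton i => exact ⟨0, Or.inl (by simpa using Related.mul_sq (a i) (hx i (by simp)))⟩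
  | cons i s hi hs ih =>
    obtain ⟨m, hm⟩ := ih fun j hj => hx j (by simp [hj])
    rw [Finset.cons_val, Multiset.map_cons, Finset.sum_cons]
    set S := ∑ j ∈ s, a j * x j ^ 2
    set b := a i * x i ^ 2
    have hb : Related {a i} {b} := Related.mul_sq (a i) (hx i (by simp))
    rcases hm with hm | ⟨c, hm⟩
    · have h1 : Related (a i ::ₘ s.val.map a) ({b, S} + m) := by
        rw [pair_add_eq_cons_cons]
        simpa only [Multiset.singleton_add] using hb.add hm
      by_cases h0 : b + S = 0
      · refine ⟨m, Or.inr ⟨b, ?_⟩⟩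
        rwa [eq_neg_of_add_eq_zero_right h0, pair_add_eq_cons_cons] at h1
      · refine ⟨(b * S * (b + S)) ::ₘ m, Or.inl ?_⟩
        rw [← pair_add_eq_cons_cons]
        exact h1.trans ((Related.pair h0).add (.refl m))
    · refine ⟨b ::ₘ m, Or.inr ⟨c, ?_⟩⟩
      rw [Multiset.cons_swap (-c) b, Multiset.cons_swap c b]
      simpa only [Multiset.singleton_add] using hb.add hm

/-- A metabolic diagonal form has trivial class: split off hyperbolic planes (or zero weights) one
after the other. -/
theorem sum_cls_eq_zero (m : Multiset F) (hm : MetabolicWeights m) : (m.map cls).sum = 0 := by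
  classical
  induction h : m.card using Nat.strong_induction_on generalizing m with
  | _ n ih =>
  obtain ⟨N, a, rfl, W, hW⟩ := id hm
  by_cases h0 : N = 0
  · subst h0; simp
  have hne : ∃ x ∈ W, x ≠ 0 := by
    by_contra! hcon
    have h1 : Pi.single ⟨0, Nat.pos_of_ne_zero h0⟩ 1 ∈ W :=
      (hW _).2 fun y hy => by simp [hcon y hy]
    simpa using congrFun (hcon _ h1) ⟨0, Nat.pos_of_ne_zero h0⟩
  obtain ⟨x, hxW, hx0⟩ := hne
  have hiso := (hW x).1 hxW x hxW
  set s : Finset (Fin N) := Finset.univ.filter fun i => x i ≠ 0 with hs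
  have hsne : s.Nonempty := by
    obtain ⟨i, hi⟩ := Function.ne_iff.1 hx0
    exact ⟨i, by simpa [hs] using hi⟩
  obtain ⟨k, hk⟩ := exists_related_sum_cons a x s hsne (by simp [hs])
  have hsum : ∑ i ∈ s, a i * x i ^ 2 = 0 := by
    rw [← hiso, hs, Finset.sum_filter_of_ne]
    · exact Finset.sum_congr rfl fun i _ => by ring
    · intro i _ hi hx; simp [hx] at hi
  have hsplit : Finset.univ.val.map a = s.val.map a + sᶜ.val.map a := by
    rw [← Multiset.map_add, ← Finset.disjUnion_val s sᶜ disjoint_compl_right,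
      Finset.disjUnion_eq_union, Finset.union_compl]
  rw [hsum] at hk
  have key : ∀ j l : Multiset F, MetabolicWeights j → (j.map cls).sum = 0 → 0 < j.card →
      Related (s.val.map a) (j + l) → ((Finset.univ.val.map a).map cls).sum = 0 := by
    intro j l hj hj0 hjc hR
    have hR' := hR.add (.refl (sᶜ.val.map a))
    rw [← hsplit, add_assoc] at hR'
    rw [hR'.2.1, Multiset.map_add, Multiset.sum_add, hj0, zero_add]
    refine ih _ ?_ _ ((hR'.metabolicWeights hm).cancel hj) rfl
    rw [← h, hR'.1, Multiset.card_add j]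
    omega
  rcases hk with hk | ⟨c, hk⟩
  · exact key {0} k .singleton_zero (by simp [isWittMap_cls.zero]) (by simp)
      (by simpa using hk)
  · refine key {c, -c} k (.pair c) (by simp [cls_neg]) (by simp) ?_
    rwa [pair_add_eq_cons_cons]

/-- Every element of the subgroup of relations is a difference of two metabolic families, and
metabolic families cancel. -/
theorem metabolicWeights_of_sum_cls_eq_zero (m : Multiset F) (hm : (m.map cls).sum = 0) :
    MetabolicWeights m := by
  classical
  let gen : Multiset F → FreeAbelianGroup F := fun m => (m.map .of).sum
  let S : AddSubgroup (FreeAbelianGroup F) :=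
    { carrier := {x | ∃ k l, MetabolicWeights k ∧ MetabolicWeights l ∧ x = gen k - gen l}
      zero_mem' := ⟨{0}, {0}, .singleton_zero, .singleton_zero, by simp⟩
      add_mem' := by
        rintro _ _ ⟨k, l, hk, hl, rfl⟩ ⟨k', l', hk', hl', rfl⟩
        exact ⟨k + k', l + l', hk.add hk', hl.add hl', by simp [gen]; abel⟩
      neg_mem' := by
        rintro _ ⟨k, l, hk, hl, rfl⟩
        exact ⟨l, k, hl, hk, by simp⟩ }
  have hrel : ∀ {k l : Multiset F}, Related k l → gen k - gen l ∈ S := by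
    intro k l h
    exact ⟨k + l.map (fun c => -c), l + l.map (fun c => -c), h.2.2, .add_neg l, by simp [gen]⟩
  have hle : AddSubgroup.closure (wittRelations F) ≤ S := by
    rw [AddSubgroup.closure_le]
    rintro x (rfl | ⟨a, b, hb, rfl⟩ | ⟨a, b, rfl⟩)
    · exact ⟨{0} + {0}, {0}, .add .singleton_zero .singleton_zero, .singleton_zero, by simp [gen]⟩
    · have := S.neg_mem (hrel (Related.mul_sq a hb))
      simpa [gen] using this
    · by_cases h0 : a + b = 0
      · rw [h0, eq_neg_of_add_eq_zero_right h0]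
        refine ⟨{a, -a}, {0} + {0}, .pair a, .add .singleton_zero .singleton_zero, ?_⟩
        simp [gen, sub_sub]
      · have := hrel (Related.pair h0)
        simpa [gen, sub_sub] using this
  have hmem : gen m ∈ AddSubgroup.closure (wittRelations F) := by
    rw [← QuotientAddGroup.eq_zero_iff, ← hm]
    change QuotientAddGroup.mk' _ (gen m) = _
    rw [map_multiset_sum, Multiset.map_map]
    rfl
  obtain ⟨k, l, hk, hl, hkl⟩ := hle hmem
  have hml : l + m = k := by
    ext c
    have hcount : ∀ j : Multiset F,
        FreeAbelianGroup.lift (fun a => if c = a then (1 : ℤ) else 0) (gen j) = j.count c := by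
      intro j
      induction j using Multiset.induction_on with
      | empty => simp [gen]
      | cons a j ih =>
        have : gen (a ::ₘ j) = .of a + gen j := by simp [gen]
        rw [this, map_add, ih, FreeAbelianGroup.lift_apply_of, Multiset.count_cons]
        push_cast
        ring
    have := congrArg (FreeAbelianGroup.lift (fun a => if c = a then (1 : ℤ) else 0)) hkl
    rw [map_sub, hcount, hcount, hcount] at this
    rw [Multiset.count_add]
    omega
  rw [← hml] at hk
  exact hk.cancel hl

end WittGroup

/-! ### Residues of rational Witt classes -/

namespace WittGroup

section Residue

variable (p : ℕ) [hp : Fact p.Prime]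

/-- The residue at `p` of the form `a * x ^ 2` over `ℚ`: zero if `a` has even valuation, and the
class of the reduced unit part of `a` otherwise. The junk valuation of `0` is even. -/
def residue (a : ℚ) : WittGroup (ZMod p) :=
  if Even (padicValRat p a) then 0 else cls ((a / (p : ℚ) ^ padicValRat p a : ℚ) : ZMod p)

variable {p}

theorem den_ne_zero_of_padicValRat_nonneg {q : ℚ} (h : 0 ≤ padicValRat p q) :
    (q.den : ZMod p) ≠ 0 := by
  intro h0
  rw [ZMod.natCast_eq_zero_iff] at h0
  have h1 : ¬ (p : ℤ) ∣ q.num := by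
    intro h2
    have h3 : p ∣ q.num.natAbs := Int.natCast_dvd.1 h2
    have := Nat.dvd_gcd h3 h0
    rw [q.reduced] at this
    exact hp.out.one_lt.ne' (Nat.dvd_one.1 this)
  have h2 : padicValInt p q.num = 0 := padicValInt.eq_zero_of_not_dvd h1
  have h3 := one_le_padicValNat_of_dvd q.den_ne_zero h0
  rw [padicValRat, h2] at h
  omega

theorem num_ne_zero_of_padicValRat_eq_zero {q : ℚ} (hq : q ≠ 0) (h : padicValRat p q = 0) :
    (q.num : ZMod p) ≠ 0 := by
  intro h0
  rw [ZMod.intCast_zmod_eq_zero_iff_dvd] at h0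
  have h1 : padicValNat p q.den = 0 := by
    apply padicValNat.eq_zero_of_not_dvd
    rw [← ZMod.natCast_eq_zero_iff]
    exact den_ne_zero_of_padicValRat_nonneg h.ge
  have h2 : padicValInt p q.num ≠ 0 := by
    rw [padicValInt]
    have := one_le_padicValNat_of_dvd (Int.natAbs_ne_zero.2 (Rat.num_ne_zero.2 hq))
      (Int.natCast_dvd.1 h0)
    omega
  rw [padicValRat, h1] at h
  omega

theorem cast_ne_zero_of_padicValRat_eq_zero {q : ℚ} (hq : q ≠ 0) (h : padicValRat p q = 0) :
    (q : ZMod p) ≠ 0 := by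
  rw [Rat.cast_def]
  exact div_ne_zero (num_ne_zero_of_padicValRat_eq_zero hq h)
    (den_ne_zero_of_padicValRat_nonneg h.ge)

theorem cast_eq_zero_of_padicValRat_pos {q : ℚ} (h : 0 < padicValRat p q) :
    (q : ZMod p) = 0 := by
  rw [Rat.cast_def]
  have h1 : (p : ℤ) ∣ q.num := by
    by_contra h2
    have h3 : padicValInt p q.num = 0 := padicValInt.eq_zero_of_not_dvd h2
    rw [padicValRat, h3] at h
    omega
  rw [(ZMod.intCast_zmod_eq_zero_iff_dvd _ _).2 h1, zero_div]

theorem prime_ne_zero_rat : (p : ℚ) ≠ 0 := Nat.cast_ne_zero.2 hp.out.ne_zero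

theorem padicValRat_unitPart {a : ℚ} (ha : a ≠ 0) :
    padicValRat p (a / (p : ℚ) ^ padicValRat p a) = 0 := by
  have hz : padicValRat p ((p : ℚ) ^ padicValRat p a) = padicValRat p a := by
    rw [padicValRat.zpow, padicValRat.self hp.out.one_lt, mul_one]
  rw [padicValRat.div ha (zpow_ne_zero _ prime_ne_zero_rat), hz, sub_self]

theorem residue_zero : residue p 0 = 0 := by simp [residue]

theorem residue_of_padicValRat_eq_zero {a : ℚ} (h : padicValRat p a = 0) : residue p a = 0 := by
  simp [residue, h]

theorem residue_mul_sq (a : ℚ) {b : ℚ} (hb : b ≠ 0) : residue p (a * b ^ 2) = residue p a := by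
  by_cases ha : a = 0
  · simp [ha]
  have hv : padicValRat p (a * b ^ 2) = padicValRat p a + 2 * padicValRat p b := by
    rw [padicValRat.mul ha (pow_ne_zero _ hb), padicValRat.pow]
    norm_num
  have hpar : Even (padicValRat p (a * b ^ 2)) ↔ Even (padicValRat p a) := by
    rw [hv, Int.even_add]
    simp
  unfold residue
  by_cases he : Even (padicValRat p a)
  · rw [if_pos he, if_pos (hpar.2 he)]
  rw [if_neg he, if_neg (mt hpar.1 he)]
  have hu : a * b ^ 2 / (p : ℚ) ^ padicValRat p (a * b ^ 2) =
      a / (p : ℚ) ^ padicValRat p a * (b / (p : ℚ) ^ padicValRat p b) ^ 2 := by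
    rw [hv, zpow_add₀ prime_ne_zero_rat, two_mul, zpow_add₀ prime_ne_zero_rat]
    field_simp
  have hb0 : b / (p : ℚ) ^ padicValRat p b ≠ 0 := div_ne_zero hb (zpow_ne_zero _ prime_ne_zero_rat)
  have ha1 := den_ne_zero_of_padicValRat_nonneg (padicValRat_unitPart (p := p) ha).ge
  have hb1 := den_ne_zero_of_padicValRat_nonneg (padicValRat_unitPart (p := p) hb).ge
  have hbb : (((b / (p : ℚ) ^ padicValRat p b) ^ 2 : ℚ).den : ZMod p) ≠ 0 := by
    rw [Rat.den_pow, Nat.cast_pow]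
    exact pow_ne_zero _ hb1
  rw [hu, Rat.cast_mul_of_ne_zero ha1 hbb, sq, Rat.cast_mul_of_ne_zero hb1 hb1, ← sq]
  exact isWittMap_cls.mul_sq _ _
    (cast_ne_zero_of_padicValRat_eq_zero hb0 (padicValRat_unitPart hb))

theorem residue_neg (a : ℚ) : residue p (-a) = -residue p a := by
  unfold residue
  rw [padicValRat.neg, neg_div]
  split_ifs
  · simp
  · rw [Rat.cast_neg, cls_neg]

/-- Residues do not see a factor that is congruent to `1`. -/
theorem residue_mul_one_add (a : ℚ) {t : ℚ} (ht : 0 < padicValRat p t) :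
    residue p (a * (1 + t)) = residue p a := by
  by_cases ha : a = 0
  · simp [ha]
  have h1 : 1 + t ≠ 0 := by
    intro h
    have : t = -1 := by linarith
    simp [this] at ht
  have hv1 : padicValRat p (1 + t) = 0 := by
    have := padicValRat.add_eq_of_lt (p := p) h1 one_ne_zero
      (by rintro rfl; simp at ht) (by simpa using ht)
    simpa using this
  have hv : padicValRat p (a * (1 + t)) = padicValRat p a := by
    rw [padicValRat.mul ha h1, hv1, add_zero]
  unfold residue
  rw [hv, mul_div_right_comm, Rat.cast_mul_of_ne_zero
    (den_ne_zero_of_padicValRat_nonneg (padicValRat_unitPart (p := p) ha).ge)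
    (den_ne_zero_of_padicValRat_nonneg hv1.ge),
    Rat.cast_add_of_ne_zero (by simp) (den_ne_zero_of_padicValRat_nonneg ht.le),
    cast_eq_zero_of_padicValRat_pos ht, Rat.cast_one, add_zero, mul_one]

theorem residue_add_of_lt {a b : ℚ} (ha : a ≠ 0) (hb : b ≠ 0)
    (h : padicValRat p a < padicValRat p b) :
    residue p a + residue p b = residue p (a + b) + residue p (a * b * (a + b)) := by
  have ht : 0 < padicValRat p (b / a) := by
    rw [padicValRat.div hb ha]; omega
  have e1 : a + b = a * (1 + b / a) := by field_simp
  have e2 : a * b * (a + b) = b * (1 + b / a) * a ^ 2 := by field_simp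
  rw [e2, residue_mul_sq _ ha, residue_mul_one_add _ ht, e1, residue_mul_one_add _ ht]

theorem isWittMap_residue : IsWittMap (residue p) where
  zero := residue_zero
  mul_sq a _ hb := residue_mul_sq a hb
  add a b := by
    by_cases ha : a = 0
    · simp [ha, residue_zero, add_comm]
    by_cases hb : b = 0
    · simp [hb, residue_zero]
    by_cases hab : a + b = 0
    · rw [hab, eq_neg_of_add_eq_zero_right hab, residue_neg, mul_zero, residue_zero]
      simp
    rcases lt_trichotomy (padicValRat p a) (padicValRat p b) with h | h | h
    · exact residue_add_of_lt ha hb h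
    · have hmin := padicValRat.min_le_padicValRat_add (p := p) hab
      rw [← h, min_self] at hmin
      rcases hmin.eq_or_lt with hs | hs
      · have hv : padicValRat p (a * b * (a + b)) = 3 * padicValRat p a := by
          rw [padicValRat.mul (mul_ne_zero ha hb) hab, padicValRat.mul ha hb, ← h, ← hs]; ring
        by_cases he : Even (padicValRat p a)
        · have he3 : Even (3 * padicValRat p a) := he.mul_left 3
          unfold residue
          rw [hv, ← h, ← hs, if_pos he, if_pos he, if_pos he, if_pos he3]
        · have he3 : ¬ Even (3 * padicValRat p a) := by
            rw [Int.even_mul]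
            rintro (h | h)
            · exact absurd h (by decide)
            · exact he h
          have ha1 := den_ne_zero_of_padicValRat_nonneg (padicValRat_unitPart (p := p) ha).ge
          have hb1 := den_ne_zero_of_padicValRat_nonneg (padicValRat_unitPart (p := p) hb).ge
          have hs1 := den_ne_zero_of_padicValRat_nonneg (padicValRat_unitPart (p := p) hab).ge
          rw [← h] at hb1
          rw [← hs] at hs1
          have hab1 : ((a / (p : ℚ) ^ padicValRat p a * (b / (p : ℚ) ^ padicValRat p a) : ℚ).den
              : ZMod p) ≠ 0 := by
            apply den_ne_zero_of_padicValRat_nonneg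
            have e1 := padicValRat_unitPart (p := p) ha
            have e2 := padicValRat_unitPart (p := p) hb
            rw [← h] at e2
            rw [padicValRat.mul (div_ne_zero ha (zpow_ne_zero _ prime_ne_zero_rat))
              (div_ne_zero hb (zpow_ne_zero _ prime_ne_zero_rat)), e1, e2]
            simp
          have e : a * b * (a + b) / (p : ℚ) ^ (3 * padicValRat p a) =
              a / (p : ℚ) ^ padicValRat p a * (b / (p : ℚ) ^ padicValRat p a) *
                ((a + b) / (p : ℚ) ^ padicValRat p a) := by
            rw [mul_comm 3, zpow_mul, zpow_ofNat]
            field_simp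
          unfold residue
          rw [hv, ← h, ← hs, if_neg he, if_neg he, if_neg he, if_neg he3, e,
            Rat.cast_mul_of_ne_zero hab1 hs1, Rat.cast_mul_of_ne_zero ha1 hb1, add_div,
            Rat.cast_add_of_ne_zero ha1 hb1]
          exact isWittMap_cls.add _ _
      · have ht : 0 < padicValRat p (-((a + b) / a)) := by
          rw [padicValRat.neg, padicValRat.div hab ha]; omega
        have e1 : b = -a * (1 + -((a + b) / a)) := by field_simp; ring
        have e2 : a * b * (a + b) = -(a + b) * (1 + -((a + b) / a)) * a ^ 2 := by
          field_simp; ring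
        have hb' : residue p b = -residue p a := by
          conv_lhs => rw [e1]
          rw [residue_mul_one_add _ ht, residue_neg]
        rw [e2, residue_mul_sq _ ha, residue_mul_one_add _ ht, residue_neg, hb']
        simp
    · have := residue_add_of_lt hb ha h
      rw [add_comm a b, mul_comm a b, ← this, add_comm]

variable (p) in
/-- The residue homomorphism at `p`. -/
def residueHom : WittGroup ℚ →+ WittGroup (ZMod p) := lift (residue p) isWittMap_residue

end Residue

/-- The signature of a rational Witt class. -/
def signature : WittGroup ℚ →+ ℤ :=
  lift (fun a => (SignType.sign a : ℤ))
    { zero := by simp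
      mul_sq := fun a b hb => by
        rw [sign_mul, sign_pos (by positivity : 0 < b ^ 2), mul_one]
      add := fun a b => by
        rw [sign_mul, sign_mul]
        rcases lt_trichotomy a 0 with ha | ha | ha <;> rcases lt_trichotomy b 0 with hb | hb | hb <;>
          rcases lt_trichotomy (a + b) 0 with hc | hc | hc <;>
          first
          | (exfalso; linarith)
          | simp [ha, hb, hc, sign_neg, sign_pos] }

end WittGroup

/-! ### A rational Witt class without residues is a multiple of `[1]` -/

namespace WittGroup

/-- Multiplication by the nonzero number `c`, as an endomorphism of the Witt group. -/
def scale {F : Type*} [Field F] (c : F) (hc : c ≠ 0) : WittGroup F →+ WittGroup F :=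
  lift (fun a => cls (c * a))
    { zero := by simp [isWittMap_cls.zero]
      mul_sq := fun a b hb => by rw [← mul_assoc, isWittMap_cls.mul_sq _ _ hb]
      add := fun a b => by
        rw [isWittMap_cls.add, ← mul_add,
          show c * a * (c * b) * (c * (a + b)) = c * (a * b * (a + b)) * c ^ 2 by ring,
          isWittMap_cls.mul_sq _ _ hc] }

/-- All prime factors of `n` are smaller than `k`. In particular `n ≠ 0`. -/
def Smooth (k : ℕ) (n : ℤ) : Prop := ∀ q : ℕ, q.Prime → (q : ℤ) ∣ n → q < k

namespace Smooth

variable {k : ℕ} {m n : ℤ}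

theorem ne_zero (h : Smooth k n) : n ≠ 0 := by
  rintro rfl
  obtain ⟨q, hq, hp⟩ := Nat.exists_infinite_primes k
  exact absurd (h q hp (dvd_zero _)) (by omega)

theorem mul (hm : Smooth k m) (hn : Smooth k n) : Smooth k (m * n) := fun q hq h =>
  (Int.Prime.dvd_mul' hq h).elim (hm q hq) (hn q hq)

theorem of_dvd (hn : Smooth k n) (h : m ∣ n) : Smooth k m := fun q hq h' => hn q hq (h'.trans h)

theorem of_abs_lt (h0 : n ≠ 0) (h : |n| < k) : Smooth k n := fun q _ hqn => by
  have := Int.le_of_dvd (abs_pos.2 h0) ((dvd_abs _ _).2 hqn)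
  omega

end Smooth

/-- The subgroup generated by the classes of the integers with all prime factors below `k`. -/
def smoothClasses (k : ℕ) : AddSubgroup (WittGroup ℚ) :=
  AddSubgroup.closure {x | ∃ n : ℤ, Smooth k n ∧ x = cls (n : ℚ)}

theorem cls_mem_smoothClasses {k : ℕ} {n : ℤ} (h : Smooth k n) :
    cls (n : ℚ) ∈ smoothClasses k :=
  AddSubgroup.subset_closure ⟨n, h, rfl⟩

theorem smoothClasses_mono {k l : ℕ} (h : ∀ n, Smooth k n → Smooth l n) :
    smoothClasses k ≤ smoothClasses l :=
  AddSubgroup.closure_mono (by rintro x ⟨n, hn, rfl⟩; exact ⟨n, h n hn, rfl⟩)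

theorem exists_mem_smoothClasses (x : WittGroup ℚ) : ∃ k, x ∈ smoothClasses k := by
  induction x using induction_on with
  | zero => exact ⟨0, zero_mem _⟩
  | cls a =>
    by_cases ha : a = 0
    · exact ⟨0, by rw [ha, isWittMap_cls.zero]; exact zero_mem _⟩
    · have hd : (a.den : ℚ) ≠ 0 := Nat.cast_ne_zero.2 a.den_ne_zero
      have h0 : a.num * a.den ≠ 0 :=
        mul_ne_zero (Rat.num_ne_zero.2 ha) (Int.natCast_ne_zero.2 a.den_ne_zero)
      refine ⟨(a.num * a.den).natAbs + 1, ?_⟩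
      have h1 := cls_mem_smoothClasses
        (Smooth.of_abs_lt (k := (a.num * a.den).natAbs + 1) h0
          (by rw [Int.abs_eq_natAbs]; omega))
      rw [← isWittMap_cls.mul_sq _ _ (inv_ne_zero hd)] at h1
      convert h1 using 2
      push_cast
      conv_lhs => rw [← Rat.num_div_den a]
      field_simp
  | neg x hx => exact hx.imp fun k h => neg_mem h
  | add x y hx hy =>
    obtain ⟨k, hk⟩ := hx
    obtain ⟨l, hl⟩ := hy
    exact ⟨max k l, add_mem
      (smoothClasses_mono (fun n h q hq hqn => (h q hq hqn).trans_le (le_max_left _ _)) hk)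
      (smoothClasses_mono (fun n h q hq hqn => (h q hq hqn).trans_le (le_max_right _ _)) hl)⟩

theorem scale_mem_smoothClasses {k : ℕ} {n : ℤ} (hn : Smooth k n) (h0 : (n : ℚ) ≠ 0)
    {x : WittGroup ℚ} (hx : x ∈ smoothClasses k) : scale (n : ℚ) h0 x ∈ smoothClasses k := by
  induction hx using AddSubgroup.closure_induction with
  | mem x hx =>
    obtain ⟨m, hm, rfl⟩ := hx
    have := cls_mem_smoothClasses (hn.mul hm)
    push_cast at this
    simpa [scale] using this
  | zero => simp
  | add x y _ _ hx hy => rw [map_add]; exact add_mem hx hy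
  | neg x _ hx => rw [map_neg]; exact neg_mem hx

section Prime

variable {p : ℕ} [hp : Fact p.Prime]

theorem Smooth.not_dvd {n : ℤ} (h : Smooth p n) : ¬ (p : ℤ) ∣ n :=
  fun h' => lt_irrefl _ (h p hp.out h')

/-- If `n₁ n₂ = r + p m` with all four numbers smaller than `p` in absolute value, the relation
`[pr] + [p² m] = [p n₁ n₂] + [n₁ n₂ r m]` identifies `[p n₁ n₂]` and `[pr]` up to classes of
smooth integers. -/
theorem cls_mul_sub_mem_of_abs_lt {n₁ n₂ r : ℤ} (h₁ : n₁ ≠ 0) (h₂ : n₂ ≠ 0) (h₁' : |n₁| < p)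
    (h₂' : |n₂| < p) (hr : |r| < p) (h : (p : ℤ) ∣ n₁ * n₂ - r) :
    cls ((p * (n₁ * n₂) : ℤ) : ℚ) - cls ((p * r : ℤ) : ℚ) ∈ smoothClasses p := by
  obtain ⟨m, hm⟩ := h
  have hp0 : (0 : ℤ) < p := by exact_mod_cast hp.out.pos
  have s₁ := Smooth.of_abs_lt h₁ h₁'
  have s₂ := Smooth.of_abs_lt h₂ h₂'
  have hr0 : r ≠ 0 := by
    rintro rfl
    exact (s₁.mul s₂).not_dvd ⟨m, by linarith⟩
  by_cases hm0 : m = 0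
  · have : n₁ * n₂ = r := by rw [hm0] at hm; linarith
    rw [this, sub_self]
    exact zero_mem _
  have hmp : |m| < p := by
    have e1 : p * |m| ≤ |n₁| * |n₂| + |r| := by
      have e : p * |m| = |p * m| := by rw [abs_mul, abs_of_pos hp0]
      rw [e, ← hm, ← abs_mul]
      exact abs_sub _ _
    have e2 : |n₁| * |n₂| ≤ (p - 1) * (p - 1) :=
      mul_le_mul (by omega) (by omega) (abs_nonneg _) (by omega)
    by_contra! hcon
    nlinarith
  have sm := Smooth.of_abs_lt hm0 hmp
  have sr := Smooth.of_abs_lt hr0 hr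
  have hadd := isWittMap_cls.add ((p * r : ℤ) : ℚ) ((p * (p * m) : ℤ) : ℚ)
  have hpq : (p : ℚ) ≠ 0 := Nat.cast_ne_zero.2 hp.out.ne_zero
  have hmq : (n₁ : ℚ) * n₂ - r = p * m := by exact_mod_cast hm
  have e1 : ((p * (p * m) : ℤ) : ℚ) = (m : ℤ) * (p : ℚ) ^ 2 := by push_cast; ring
  have e2 : ((p * r : ℤ) : ℚ) + ((p * (p * m) : ℤ) : ℚ) = ((p * (n₁ * n₂) : ℤ) : ℚ) := by
    push_cast; linear_combination -(p : ℚ) * hmq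
  have e3 : ((p * r : ℤ) : ℚ) * ((p * (p * m) : ℤ) : ℚ) * ((p * (n₁ * n₂) : ℤ) : ℚ) =
      ((r * m * (n₁ * n₂) : ℤ) : ℚ) * ((p : ℚ) ^ 2) ^ 2 := by push_cast; ring
  rw [e2, e3, isWittMap_cls.mul_sq _ _ (pow_ne_zero _ hpq), e1,
    isWittMap_cls.mul_sq _ _ hpq] at hadd
  have : cls ((p * (n₁ * n₂) : ℤ) : ℚ) - cls ((p * r : ℤ) : ℚ) =
      cls (m : ℚ) - cls ((r * m * (n₁ * n₂) : ℤ) : ℚ) := by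
    rw [sub_eq_sub_iff_add_eq_add, ← hadd, add_comm]
  rw [this]
  exact sub_mem (cls_mem_smoothClasses sm)
    (cls_mem_smoothClasses ((sr.mul sm).mul (s₁.mul s₂)))

/-- For smooth `n`, the class `[p n]` depends only on `n` modulo `p`, up to classes of smooth
integers. -/
theorem cls_mul_sub_mem {n : ℤ} (hn : Smooth p n) {r : ℤ} (hr : |r| < p)
    (h : (p : ℤ) ∣ n - r) :
    cls ((p * n : ℤ) : ℚ) - cls ((p * r : ℤ) : ℚ) ∈ smoothClasses p := by
  induction hN : n.natAbs using Nat.strong_induction_on generalizing n r with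
  | _ N ih =>
  have hp1 : (1 : ℤ) < p := by exact_mod_cast hp.out.one_lt
  by_cases hlt : |n| < p
  · have := cls_mul_sub_mem_of_abs_lt hn.ne_zero one_ne_zero hlt (by simpa using hp1) hr
      (by simpa using h)
    simpa using this
  obtain ⟨q, hq, hqn⟩ := Nat.exists_prime_and_dvd (n := n.natAbs) (by
    rw [Int.abs_eq_natAbs] at hlt; omega)
  obtain ⟨n', rfl⟩ := Int.natCast_dvd.2 hqn
  have hn' : Smooth p n' := hn.of_dvd (dvd_mul_left _ _)
  have sq : Smooth p (q : ℤ) := hn.of_dvd (dvd_mul_right _ _)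
  have hq0 : (q : ℤ) ≠ 0 := sq.ne_zero
  have hqp : q < p := hn q hq (dvd_mul_right _ _)
  have hr0 := Int.emod_nonneg n' (by omega : (p : ℤ) ≠ 0)
  have hrp := Int.emod_lt_of_pos n' (by omega : (0 : ℤ) < p)
  have hr' : |n' % p| < p := by rwa [abs_of_nonneg hr0]
  have hdvd : (p : ℤ) ∣ n' - n' % p := Int.dvd_self_sub_emod
  have h1 := ih n'.natAbs (by
    rw [← hN, Int.natAbs_mul, Int.natAbs_natCast]
    have := Int.natAbs_pos.2 hn'.ne_zero
    nlinarith [hq.two_le]) hn' hr' hdvd rfl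
  have hqq : ((q : ℤ) : ℚ) ≠ 0 := by exact_mod_cast hq0
  have h2 := scale_mem_smoothClasses sq hqq h1
  have hne : n' % p ≠ 0 := fun h0 => hn'.not_dvd (Int.dvd_of_emod_eq_zero h0)
  have h3 := cls_mul_sub_mem_of_abs_lt hq0 hne (by simpa using hqp) hr' hr (by
    have : (q : ℤ) * (n' % p) - r = (q * n' - r) - q * (n' - n' % p) := by ring
    rw [this]
    exact dvd_sub h (hdvd.mul_left _))
  have h4 := add_mem h2 h3
  simp only [scale, map_sub, lift_cls] at h4
  convert h4 using 1
  rw [show ((q : ℤ) : ℚ) * ((p * n' : ℤ) : ℚ) = ((p * (q * n') : ℤ) : ℚ) by push_cast; ring,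
    show ((q : ℤ) : ℚ) * ((p * (n' % p) : ℤ) : ℚ) = ((p * (q * (n' % p)) : ℤ) : ℚ) by
      push_cast; ring]
  abel

variable (p) in
/-- The class of `p` times the representative of `u` in `[0, p)`, modulo smooth classes. -/
def transfer (u : ZMod p) : WittGroup ℚ ⧸ smoothClasses p :=
  QuotientAddGroup.mk (cls ((p * u.val : ℤ) : ℚ))

theorem mk_cls_mul {n : ℤ} (hn : n = 0 ∨ Smooth p n) :
    (QuotientAddGroup.mk (cls ((p * n : ℤ) : ℚ)) : WittGroup ℚ ⧸ smoothClasses p) =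
      transfer p (n : ZMod p) := by
  rcases hn with rfl | hn
  · simp [transfer]
  · have hv := (n : ZMod p).val_lt
    have hmem := cls_mul_sub_mem hn (r := ((n : ZMod p).val : ℤ)) (by
      rw [Nat.abs_cast]; exact_mod_cast hv) (by
      rw [← ZMod.intCast_zmod_eq_zero_iff_dvd]
      simp)
    rw [← QuotientAddGroup.eq_zero_iff, QuotientAddGroup.mk_sub, sub_eq_zero] at hmem
    exact hmem

theorem smooth_val {u : ZMod p} (hu : u ≠ 0) : Smooth p (u.val : ℤ) :=
  Smooth.of_abs_lt (by exact_mod_cast (ZMod.val_ne_zero u).2 hu)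
    (by rw [Nat.abs_cast]; exact_mod_cast u.val_lt)

theorem isWittMap_transfer : IsWittMap (transfer p) where
  zero := by simp [transfer, isWittMap_cls.zero]
  mul_sq a b hb := by
    by_cases ha : a = 0
    · simp [ha]
    have hs := ((smooth_val ha).mul ((smooth_val hb).mul (smooth_val hb)))
    have h1 := mk_cls_mul (Or.inr hs)
    have hbq : ((b.val : ℤ) : ℚ) ≠ 0 := by exact_mod_cast (smooth_val hb).ne_zero
    rw [show ((p * (a.val * (b.val * b.val)) : ℤ) : ℚ) =
      ((p * a.val : ℤ) : ℚ) * ((b.val : ℤ) : ℚ) ^ 2 by push_cast; ring,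
      isWittMap_cls.mul_sq _ _ hbq, mk_cls_mul (Or.inr (smooth_val ha))] at h1
    have e1 : ((a.val * (b.val * b.val) : ℤ) : ZMod p) = a * b ^ 2 := by
      simp only [Int.cast_mul, Int.cast_natCast, ZMod.natCast_zmod_val]; ring
    have e2 : ((a.val : ℤ) : ZMod p) = a := by simp
    rw [e1, e2] at h1
    exact h1.symm
  add a b := by
    by_cases ha : a = 0
    · rw [ha, zero_mul, zero_mul, zero_add, add_comm]
    by_cases hb : b = 0
    · rw [hb, mul_zero, zero_mul, add_zero]
    have hpq : (p : ℚ) ≠ 0 := Nat.cast_ne_zero.2 hp.out.ne_zero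
    -- Representatives are chosen with a small sum.
    obtain ⟨B, hB, hBb, hsum⟩ : ∃ B : ℤ, Smooth p B ∧ (B : ZMod p) = b ∧
        |(a.val : ℤ) + B| < p := by
      have ha1 := a.val_lt
      have hb1 := b.val_lt
      have ha0 := (ZMod.val_ne_zero a).2 ha
      have hb0 := (ZMod.val_ne_zero b).2 hb
      by_cases hlt : a.val + b.val < p
      · exact ⟨b.val, smooth_val hb, by simp, by rw [abs_of_nonneg] <;> omega⟩
      · refine ⟨b.val - p, Smooth.of_abs_lt (by omega) ?_, by simp, ?_⟩ <;>
          rw [abs_lt] <;> omega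
    have hA := smooth_val ha
    have e2 : ((a.val : ℤ) : ZMod p) = a := by simp
    have hS : (a.val : ℤ) + B = 0 ∨ Smooth p ((a.val : ℤ) + B) := by
      by_cases h0 : (a.val : ℤ) + B = 0
      · exact Or.inl h0
      · exact Or.inr (.of_abs_lt h0 hsum)
    have hP : (a.val : ℤ) * B * (a.val + B) = 0 ∨ Smooth p ((a.val : ℤ) * B * (a.val + B)) :=
      hS.imp (fun h => by rw [h, mul_zero]) (fun h => (hA.mul hB).mul h)
    have h1 := mk_cls_mul (Or.inr hA)
    have h2 := mk_cls_mul (Or.inr hB)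
    have h3 := mk_cls_mul hS
    have h4 := mk_cls_mul hP
    rw [e2] at h1
    rw [hBb] at h2
    rw [Int.cast_add (R := ZMod p), e2, hBb] at h3
    rw [Int.cast_mul (α := ZMod p), Int.cast_mul (α := ZMod p), Int.cast_add (R := ZMod p), e2,
      hBb] at h4
    rw [← h1, ← h2, ← h3, ← h4, ← QuotientAddGroup.mk_add, ← QuotientAddGroup.mk_add,
      isWittMap_cls.add]
    congr 2
    · congr 1; push_cast; ring
    · rw [← isWittMap_cls.mul_sq ((p * (a.val * B * (a.val + B)) : ℤ) : ℚ) _ hpq]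
      congr 1; push_cast; ring

/-- On classes of integers with prime factors at most `p`, the residue at `p` determines the class
modulo the classes of integers with prime factors less than `p`. -/
theorem lift_transfer_residueHom {x : WittGroup ℚ} (hx : x ∈ smoothClasses (p + 1)) :
    lift (transfer p) isWittMap_transfer (residueHom p x) = QuotientAddGroup.mk x := by
  induction hx using AddSubgroup.closure_induction with
  | mem x hx =>
    obtain ⟨n, hn, rfl⟩ := hx
    have hpq : (p : ℚ) ≠ 0 := Nat.cast_ne_zero.2 hp.out.ne_zero
    obtain ⟨k, u, hu, hnu⟩ : ∃ (k : ℕ) (u : ℤ), ¬ (p : ℤ) ∣ u ∧ n = p ^ k * u := by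
      have hfin : FiniteMultiplicity (p : ℤ) n := padicValRat.finite_int_prime_iff.2 hn.ne_zero
      obtain ⟨u, hnu, hu⟩ := hfin.exists_eq_pow_mul_and_not_dvd
      exact ⟨_, u, hu, hnu⟩
    have hus : Smooth p u := by
      intro q hq hqu
      have h1 := hn q hq (by rw [hnu]; exact hqu.mul_left _)
      have h2 : q ≠ p := by rintro rfl; exact hu hqu
      omega
    have huq : (u : ℚ) ≠ 0 := by exact_mod_cast hus.ne_zero
    have hvu : padicValRat p (u : ℚ) = 0 := by
      rw [padicValRat.of_int, padicValInt.eq_zero_of_not_dvd hu]; rfl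
    obtain ⟨j, hj⟩ := Nat.even_or_odd' k
    rcases hj with hj | hj
    · have e : (n : ℚ) = u * ((p : ℚ) ^ j) ^ 2 := by rw [hnu, hj]; push_cast; ring
      rw [e, isWittMap_cls.mul_sq _ _ (pow_ne_zero _ hpq), residueHom, lift_cls,
        residue_of_padicValRat_eq_zero hvu, map_zero]
      exact ((QuotientAddGroup.eq_zero_iff _).2 (cls_mem_smoothClasses hus)).symm
    · have e : (n : ℚ) = ((p * u : ℤ) : ℚ) * ((p : ℚ) ^ j) ^ 2 := by
        rw [hnu, hj]; push_cast; ring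
      have hv : padicValRat p ((p * u : ℤ) : ℚ) = 1 := by
        push_cast
        rw [padicValRat.mul hpq huq, hvu, padicValRat.self hp.out.one_lt, add_zero]
      have hr : residue p ((p * u : ℤ) : ℚ) = cls (u : ZMod p) := by
        rw [residue, hv, if_neg (by decide), zpow_one]
        congr 1
        rw [Int.cast_mul, Int.cast_natCast, mul_div_cancel_left₀ _ hpq, Rat.cast_intCast]
      rw [e, isWittMap_cls.mul_sq _ _ (pow_ne_zero _ hpq), residueHom, lift_cls, hr, lift_cls,
        mk_cls_mul (Or.inr hus)]
  | zero => simp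
  | add x y _ _ hx hy => rw [map_add, map_add, hx, hy, QuotientAddGroup.mk_add]
  | neg x _ hx => rw [map_neg, map_neg, hx, QuotientAddGroup.mk_neg]

end Prime

/-- A rational Witt class without residues is a multiple of `[1]`: the primes in its
representatives are removed one at a time, starting from the largest. -/
theorem eq_signature_smul_cls_one (x : WittGroup ℚ)
    (hx : ∀ (p : ℕ) [Fact p.Prime], residueHom p x = 0) : x = signature x • cls 1 := by
  have h0 : x ∈ smoothClasses 0 := by
    obtain ⟨k, hk⟩ := exists_mem_smoothClasses x
    induction k with
    | zero => exact hk
    | succ k ih =>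
      apply ih
      by_cases hp : k.Prime
      · have : Fact k.Prime := ⟨hp⟩
        have := lift_transfer_residueHom hk
        rw [hx, map_zero] at this
        exact (QuotientAddGroup.eq_zero_iff _).1 this.symm
      · refine smoothClasses_mono (fun n hn q hq hqn => ?_) hk
        have h1 := hn q hq hqn
        have h2 : q ≠ k := by rintro rfl; exact hp hq
        omega
  clear hx
  induction h0 using AddSubgroup.closure_induction with
  | mem x hx =>
    obtain ⟨n, hn, rfl⟩ := hx
    have hunit : n.natAbs = 1 := by
      by_contra h
      obtain ⟨q, hq, hqn⟩ := Nat.exists_prime_and_dvd h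
      exact absurd (hn q hq (Int.natCast_dvd.2 hqn)) (Nat.not_lt_zero _)
    rcases Int.natAbs_eq n with h | h <;> rw [hunit] at h <;> subst h <;>
      simp [signature, cls_neg]
  | zero => simp
  | add x y _ _ hx hy => rw [map_add, add_zsmul, ← hx, ← hy]
  | neg x _ hx => rw [map_neg, neg_zsmul, ← hx]

end WittGroup

/-! ### Orthogonal families in a lattice -/

namespace IntegralLattice

open Module WittGroup DiagonalForm

variable {L : Type*} [AddCommGroup L]

/-- `v` is an orthogonal family of anisotropic vectors. -/
structure IsOrthogonalFamily {ι : Type*} (B : LinearMap.BilinForm ℤ L) (v : ι → L) : Prop where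
  ortho : ∀ i j, i ≠ j → B (v i) (v j) = 0
  ne_zero : ∀ i, B (v i) (v i) ≠ 0

theorem IsOrthogonalFamily.apply_sum_smul {ι : Type*} [Fintype ι] {B : LinearMap.BilinForm ℤ L}
    {v : ι → L} (hv : IsOrthogonalFamily B v) (c : ι → ℤ) (j : ι) :
    B (∑ i, c i • v i) (v j) = c j * B (v j) (v j) := by
  rw [map_sum, LinearMap.sum_apply, Finset.sum_eq_single j]
  · simp
  · intro i _ hij
    simp [hv.ortho i j hij]
  · simp

theorem IsUnimodular.eq_zero {B : LinearMap.BilinForm ℤ L} (hu : IsUnimodular B) {z : L} (h : ∀ x, B z x = 0) : z = 0 :=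
  hu.1 (by ext x; simp [h x])

theorem IsUnimodular.exists_smul_eq {B : LinearMap.BilinForm ℤ L} (hu : IsUnimodular B)
    {p : ℤ} (hp : p ≠ 0) {z : L}
    (h : ∀ x, p ∣ B z x) : ∃ y, z = p • y := by
  choose f hf using h
  let φ : L →ₗ[ℤ] ℤ :=
    { toFun := f
      map_add' := fun x y => mul_left_cancel₀ hp (by rw [mul_add, ← hf, ← hf, ← hf, map_add])
      map_smul' := fun c x => mul_left_cancel₀ hp (by
        rw [← hf, map_smul, smul_eq_mul, smul_eq_mul, hf]; simp; ring) }
  obtain ⟨y, hy⟩ := hu.2 φ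
  refine ⟨y, sub_eq_zero.1 (hu.eq_zero fun x => ?_)⟩
  have : B y x = f x := LinearMap.congr_fun hy x
  simp [this, hf x]

section Family

variable [Module.Free ℤ L] [Module.Finite ℤ L] {B : LinearMap.BilinForm ℤ L}
  {v : Fin (finrank ℤ L) → L}

omit [Module.Free ℤ L] in
theorem IsOrthogonalFamily.exists_smul_eq_sum (hv : IsOrthogonalFamily B v) (x : L) :
    ∃ D : ℤ, D ≠ 0 ∧ ∃ c : Fin (finrank ℤ L) → ℤ, D • x = ∑ i, c i • v i := by
  have hdep : ¬ LinearIndependent ℤ (Fin.cons x v : Fin (finrank ℤ L + 1) → L) := by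
    intro h
    have := h.fintype_card_le_finrank
    simp at this
  rw [Fintype.not_linearIndependent_iff] at hdep
  obtain ⟨g, hg, i, hi⟩ := hdep
  rw [Fin.sum_univ_succ] at hg
  simp only [Fin.cons_zero, Fin.cons_succ] at hg
  refine ⟨g 0, fun h0 => ?_, fun i => -g i.succ, ?_⟩
  · rw [h0, zero_smul, zero_add] at hg
    refine Fin.cases (fun h => h h0) (fun j h => h ?_) i hi
    have := hv.apply_sum_smul (fun i => g i.succ) j
    rw [hg] at this
    simpa [hv.ne_zero j] using this.symm
  · rw [eq_neg_of_add_eq_zero_left hg]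
    simp

omit [Module.Free ℤ L] in
/-- Parseval's identity for an orthogonal family of full length. -/
theorem IsOrthogonalFamily.parseval (hs : B.IsSymm) (hv : IsOrthogonalFamily B v) (x y : L) :
    (B x y : ℚ) = ∑ i, (B x (v i) : ℚ) * B y (v i) / B (v i) (v i) := by
  obtain ⟨D, hD, c, hc⟩ := hv.exists_smul_eq_sum x
  have hDq : (D : ℚ) ≠ 0 := by exact_mod_cast hD
  have h1 : ∀ i, (D : ℚ) * B x (v i) = c i * B (v i) (v i) := by
    intro i
    have := hv.apply_sum_smul c i
    rw [← hc, map_smul, LinearMap.smul_apply, smul_eq_mul] at this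
    exact_mod_cast this
  have h2 : (D : ℚ) * B x y = ∑ i, (c i : ℚ) * B y (v i) := by
    have : D * B x y = ∑ i, c i * B y (v i) := by
      rw [← smul_eq_mul, ← LinearMap.smul_apply, ← map_smul, hc, map_sum, LinearMap.sum_apply]
      exact Finset.sum_congr rfl fun i _ => by
        rw [map_smul, LinearMap.smul_apply, smul_eq_mul, hs.eq y (v i)]
    exact_mod_cast this
  apply mul_left_cancel₀ hDq
  rw [h2, Finset.mul_sum]
  refine Finset.sum_congr rfl fun i _ => ?_
  have hi : (B (v i) (v i) : ℚ) ≠ 0 := by exact_mod_cast hv.ne_zero i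
  field_simp
  linear_combination -(B y (v i) : ℚ) * h1 i

/-- The class of a lattice in the rational Witt group, computed from the orthogonal family `v`. -/
def wittClass {ι : Type*} [Fintype ι] (B : LinearMap.BilinForm ℤ L) (v : ι → L) : WittGroup ℚ :=
  ∑ i, cls (B (v i) (v i) : ℚ)

omit [Module.Free ℤ L] in
/-- The class of a lattice does not depend on the orthogonal family: two families define isometric
rational forms. -/
theorem wittClass_eq (hs : B.IsSymm) {w : Fin (finrank ℤ L) → L} (hv : IsOrthogonalFamily B v)
    (hw : IsOrthogonalFamily B w) : wittClass B v = wittClass B w := by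
  set a : Fin (finrank ℤ L) → ℚ := fun i => B (v i) (v i) with ha
  set b : Fin (finrank ℤ L) → ℚ := fun i => B (w i) (w i) with hb
  have ha0 : ∀ i, a i ≠ 0 := fun i => by simpa [ha] using hv.ne_zero i
  have hb0 : ∀ i, b i ≠ 0 := fun i => by simpa [hb] using hw.ne_zero i
  -- The base change matrices in both directions.
  let P : Matrix (Fin (finrank ℤ L)) (Fin (finrank ℤ L)) ℚ := .of fun i j => B (w j) (v i) / a i
  let Q : Matrix (Fin (finrank ℤ L)) (Fin (finrank ℤ L)) ℚ := .of fun i j => B (v j) (w i) / b i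
  have hPQ : P * Q = 1 := by
    ext i k
    have h := hw.parseval hs (v i) (v k)
    rw [Matrix.mul_apply, Matrix.one_apply]
    have : ∑ j, P i j * Q j k = (B (v i) (v k) : ℚ) / a i := by
      rw [h, Finset.sum_div]
      refine Finset.sum_congr rfl fun j _ => ?_
      simp only [P, Q, Matrix.of_apply, hb]
      have e : B (w j) (v i) = B (v i) (w j) := hs.eq (w j) (v i)
      rw [e]
      ring
    rw [this]
    split_ifs with h
    · subst h; exact div_self (ha0 i)
    · rw [hv.ortho i k h]; simp
  have hPa : P.transpose * Matrix.diagonal a * P = Matrix.diagonal b := by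
    ext j k
    rw [Matrix.mul_apply, Matrix.diagonal_apply]
    have : ∑ i, (P.transpose * Matrix.diagonal a) j i * P i k = (B (w j) (w k) : ℚ) := by
      rw [hv.parseval hs]
      refine Finset.sum_congr rfl fun i _ => ?_
      rw [Matrix.mul_diagonal, Matrix.transpose_apply]
      simp only [P, Matrix.of_apply]
      have := ha0 i
      simp only [ha] at this ⊢
      field_simp
    rw [this]
    split_ifs with h
    · subst h; rfl
    · rw [hw.ortho j k h]; simp
  have hmet := MetabolicWeights.of_pullback (a := a) (b := b) P.mulVecLin
    (fun y => ⟨Q.mulVec y, by simp [hPQ]⟩) (fun y z => by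
      have e1 : ∑ i, a i * P.mulVecLin y i * P.mulVecLin z i =
          P.mulVec y ⬝ᵥ (Matrix.diagonal a).mulVec (P.mulVec z) := by
        simp only [dotProduct, Matrix.mulVec_diagonal, Matrix.mulVecLin_apply]
        exact Finset.sum_congr rfl fun i _ => by ring
      have e2 : ∑ j, b j * y j * z j = y ⬝ᵥ (Matrix.diagonal b).mulVec z := by
        simp only [dotProduct, Matrix.mulVec_diagonal]
        exact Finset.sum_congr rfl fun i _ => by ring
      rw [e1, e2, ← hPa, ← Matrix.mulVec_mulVec, ← Matrix.mulVec_mulVec,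
        Matrix.dotProduct_mulVec y, Matrix.vecMul_transpose])
  have hsum := sum_cls_eq_zero _ hmet
  rw [Multiset.map_add, Multiset.sum_add, Multiset.map_map, Multiset.map_map, Multiset.map_map]
    at hsum
  have : (∑ i, cls (a i)) + ∑ i, cls (-b i) = 0 := hsum
  simp only [cls_neg, Finset.sum_neg_distrib] at this
  exact eq_of_sub_eq_zero (by rw [sub_eq_add_neg]; exact this)

end Family

/-! ### Residues of a unimodular lattice -/

section Unimodular

variable [Module.Free ℤ L] [Module.Finite ℤ L] {B : LinearMap.BilinForm ℤ L}

omit [Module.Free ℤ L] [Module.Finite ℤ L] in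
/-- At an odd prime `p`, a unimodular lattice has an orthogonal family of full length with norms
prime to `p`. A maximal such family is complete: otherwise its orthogonal complement, which splits
off up to an index prime to `p`, would consist of vectors divisible by every power of `p`. -/
theorem IsUnimodular.exists_orthogonal_not_dvd (hs : B.IsSymm) (hu : IsUnimodular B) {p : ℕ}
    (hp : p.Prime) (h2 : p ≠ 2) (k : ℕ) (hk : k ≤ finrank ℤ L) :
    ∃ v : Fin k → L, (∀ i j, i ≠ j → B (v i) (v j) = 0) ∧ ∀ i, ¬ (p : ℤ) ∣ B (v i) (v i) := by
  induction k with
  | zero => exact ⟨Fin.elim0, fun i => i.elim0, fun i => i.elim0⟩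
  | succ k ih =>
  obtain ⟨v, hv, hvp⟩ := ih (by omega)
  have hpz : Prime (p : ℤ) := Nat.prime_iff_prime_int.1 hp
  have hsymm : ∀ x y, B x y = B y x := fun x y => hs.eq x y
  by_cases hex : ∃ z, (∀ i, B z (v i) = 0) ∧ ¬ (p : ℤ) ∣ B z z
  · obtain ⟨z, hz, hzp⟩ := hex
    refine ⟨Fin.cons z v, fun i j hij => ?_, fun i => ?_⟩
    · refine Fin.cases (fun hij => ?_) (fun i hij => ?_) i hij <;>
        refine Fin.cases (fun hij => ?_) (fun j hij => ?_) j hij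
      · exact absurd rfl hij
      · simpa using hz j
      · simpa [hsymm (v i) z] using hz i
      · simpa using hv i j (by simpa using hij)
    · refine Fin.cases ?_ (fun i => ?_) i
      · simpa using hzp
      · simpa using hvp i
  exfalso
  push Not at hex
  have hne : ∀ i, B (v i) (v i) ≠ 0 := fun i h => hvp i (by rw [h]; exact dvd_zero _)
  have hortho : ∀ z y, (∀ i, B z (v i) = 0) → (∀ i, B y (v i) = 0) → (p : ℤ) ∣ B z y := by
    intro z y hz hy
    have h1 := hex (z + y) fun i => by simp [hz i, hy i]
    have h3 := hex z hz
    have h4 := hex y hy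
    have h5 : (p : ℤ) ∣ 2 * B z y := by
      have : 2 * B z y = B (z + y) (z + y) - B z z - B y y := by
        simp only [map_add, LinearMap.add_apply, hsymm y z]; ring
      rw [this]
      exact dvd_sub (dvd_sub h1 h3) h4
    refine (hpz.dvd_or_dvd h5).resolve_left fun h => h2 ?_
    exact (Nat.prime_dvd_prime_iff_eq hp Nat.prime_two).1 (by exact_mod_cast h)
  have hall : ∀ z, (∀ i, B z (v i) = 0) → ∀ x, (p : ℤ) ∣ B z x := by
    intro z hz x
    set D := ∏ i, B (v i) (v i) with hD
    have hDp : ¬ (p : ℤ) ∣ D := by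
      rw [hD, hpz.dvd_finsetProd_iff]
      rintro ⟨i, _, hi⟩
      exact hvp i hi
    let x' := D • x - ∑ i, ((∏ j ∈ Finset.univ.erase i, B (v j) (v j)) * B x (v i)) • v i
    have hx' : ∀ i, B x' (v i) = 0 := by
      intro i
      have := IsOrthogonalFamily.apply_sum_smul ⟨hv, hne⟩
        (fun i => (∏ j ∈ Finset.univ.erase i, B (v j) (v j)) * B x (v i)) i
      simp only [x', map_sub, LinearMap.sub_apply, this, map_smul, LinearMap.smul_apply,
        smul_eq_mul, hD]
      rw [← Finset.mul_prod_erase _ _ (Finset.mem_univ i)]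
      ring
    have h6 := hortho z x' hz hx'
    have h7 : B z x' = D * B z x := by simp [x', hz]
    rw [h7] at h6
    exact (hpz.dvd_or_dvd h6).resolve_left hDp
  have hdiv : ∀ n : ℕ, ∀ z, (∀ i, B z (v i) = 0) → ∃ y, z = (p : ℤ) ^ n • y := by
    intro n
    induction n with
    | zero => exact fun z _ => ⟨z, by simp⟩
    | succ n ih =>
      intro z hz
      obtain ⟨y, rfl⟩ := hu.exists_smul_eq hpz.ne_zero (hall z hz)
      obtain ⟨y', rfl⟩ := ih y fun i => by simpa [hp.ne_zero] using hz i
      exact ⟨y', by rw [pow_succ', mul_smul]⟩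
  have hzero : ∀ z, (∀ i, B z (v i) = 0) → z = 0 := by
    intro z hz
    refine hu.eq_zero fun x => ?_
    by_contra hcon
    have hfin : FiniteMultiplicity (p : ℤ) (B z x) :=
      Int.finiteMultiplicity_iff.2 ⟨by simpa using hp.one_lt.ne', hcon⟩
    obtain ⟨n, hn⟩ := hfin
    obtain ⟨y, rfl⟩ := hdiv (n + 1) z hz
    exact hn (by simp)
  let φ : L →ₗ[ℤ] (Fin k → ℤ) := LinearMap.pi fun i => B (v i)
  have hφ : Function.Injective φ := by
    rw [← LinearMap.ker_eq_bot, LinearMap.ker_eq_bot']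
    intro z hz
    refine hzero z fun i => ?_
    rw [hsymm]
    exact congrFun hz i
  have := LinearMap.finrank_le_finrank_of_injective hφ
  rw [Module.finrank_fin_fun] at this
  omega

omit [Module.Free ℤ L] [Module.Finite ℤ L] in
theorem IsUnimodular.exists_isOrthogonalFamily (hs : B.IsSymm) (hu : IsUnimodular B) {p : ℕ}
    (hp : p.Prime) (h2 : p ≠ 2) :
    ∃ v : Fin (finrank ℤ L) → L, IsOrthogonalFamily B v ∧ ∀ i, ¬ (p : ℤ) ∣ B (v i) (v i) := by
  obtain ⟨v, hv, hvp⟩ := hu.exists_orthogonal_not_dvd hs hp h2 _ le_rfl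
  exact ⟨v, ⟨hv, fun i h => hvp i (by rw [h]; exact dvd_zero _)⟩, hvp⟩

/-- The discriminant of a unimodular lattice is a unit, so a product of norms is a square up to
sign. -/
theorem IsUnimodular.exists_prod_eq (hu : IsUnimodular B) {v : Fin (finrank ℤ L) → L}
    (hv : IsOrthogonalFamily B v) : ∃ c u : ℤ, IsUnit u ∧ ∏ i, B (v i) (v i) = c ^ 2 * u := by
  let e := Module.finBasis ℤ L
  let G : Matrix (Fin (finrank ℤ L)) (Fin (finrank ℤ L)) ℤ := .of fun i j => B (e i) (e j)
  let C : Matrix (Fin (finrank ℤ L)) (Fin (finrank ℤ L)) ℤ := .of fun i j => e.repr (v i) j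
  choose f hf using fun i => hu.2 (e.coord i)
  let H : Matrix (Fin (finrank ℤ L)) (Fin (finrank ℤ L)) ℤ := .of fun i j => e.repr (f i) j
  have hexp : ∀ x y, B x y = ∑ j, e.repr x j * B (e j) y := by
    intro x y
    conv_lhs => rw [← e.sum_repr x, map_sum, LinearMap.sum_apply]
    exact Finset.sum_congr rfl fun j _ => by rw [map_smul, LinearMap.smul_apply, smul_eq_mul]
  have hexp' : ∀ x y, B x y = ∑ j, B x (e j) * e.repr y j := by
    intro x y
    conv_lhs => rw [← e.sum_repr y, map_sum]
    exact Finset.sum_congr rfl fun j _ => by rw [map_smul, smul_eq_mul, mul_comm]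
  have hHG : H * G = 1 := by
    ext i j
    rw [Matrix.mul_apply, Matrix.one_apply]
    have h1 := hexp (f i) (e j)
    have h2 : B (f i) (e j) = e.coord i (e j) := LinearMap.congr_fun (hf i) (e j)
    simp only [H, G, Matrix.of_apply]
    rw [← h1, h2]
    simp [Finsupp.single_apply, eq_comm]
  have hCG : C * G * C.transpose = Matrix.diagonal fun i => B (v i) (v i) := by
    ext i j
    have : (C * G * C.transpose) i j = B (v i) (v j) := by
      rw [hexp' (v i) (v j), Matrix.mul_apply]
      refine Finset.sum_congr rfl fun k _ => ?_
      rw [hexp (v i) (e k), Matrix.mul_apply, Matrix.transpose_apply]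
      rfl
    rw [this, Matrix.diagonal_apply]
    split_ifs with h
    · rw [h]
    · exact hv.ortho i j h
  refine ⟨C.det, G.det, ?_, ?_⟩
  · have := congrArg Matrix.det hHG
    rw [Matrix.det_mul, Matrix.det_one] at this
    exact IsUnit.of_mul_eq_one_right _ this
  · rw [← Matrix.det_diagonal, ← hCG, Matrix.det_mul, Matrix.det_mul, Matrix.det_transpose]
    ring

/-- At `2` only the parity of the valuation of the discriminant matters, since the Witt group of
the field with two elements is generated by `[1]` and `2 • [1] = 0`. -/
theorem residue_two (a : ℚ) (ha : a ≠ 0) : residue 2 a = padicValRat 2 a • cls (1 : ZMod 2) := by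
  have h2 : (2 : ℤ) • cls (1 : ZMod 2) = 0 := by
    have h := isWittMap_cls.add (1 : ZMod 2) 1
    rw [show (1 : ZMod 2) + 1 = 0 by decide, mul_zero, isWittMap_cls.zero, add_zero] at h
    rw [two_zsmul, h]
  unfold residue
  split_ifs with h
  · obtain ⟨j, hj⟩ := h
    rw [hj, ← mul_two, mul_zsmul, h2, zsmul_zero]
  · obtain ⟨j, hj⟩ := Int.not_even_iff_odd.1 h
    have hu : ((a / ((2 : ℕ) : ℚ) ^ padicValRat 2 a : ℚ) : ZMod 2) ≠ 0 :=
      cast_ne_zero_of_padicValRat_eq_zero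
        (div_ne_zero ha (zpow_ne_zero _ prime_ne_zero_rat)) (padicValRat_unitPart ha)
    have hone : ∀ u : ZMod 2, u ≠ 0 → u = 1 := by decide
    rw [hone _ hu]
    nth_rewrite 1 [hj]
    rw [add_zsmul, mul_comm, mul_zsmul, h2, zsmul_zero, zero_add, one_zsmul]

theorem IsUnimodular.residueHom_wittClass (hs : B.IsSymm) (hu : IsUnimodular B)
    {v : Fin (finrank ℤ L) → L} (hv : IsOrthogonalFamily B v) (p : ℕ) [hp : Fact p.Prime] :
    residueHom p (wittClass B v) = 0 := by
  by_cases h2 : p = 2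
  · subst h2
    obtain ⟨c, u, hunit, hprod⟩ := hu.exists_prod_eq hv
    have hne : ∀ i, (B (v i) (v i) : ℚ) ≠ 0 := fun i => by exact_mod_cast hv.ne_zero i
    have hval : ∀ s : Finset (Fin (finrank ℤ L)),
        padicValRat 2 (∏ i ∈ s, (B (v i) (v i) : ℚ)) = ∑ i ∈ s, padicValRat 2 (B (v i) (v i)) := by
      intro s
      induction s using Finset.cons_induction with
      | empty => simp
      | cons i s hi ih =>
        rw [Finset.prod_cons, Finset.sum_cons,
          padicValRat.mul (hne i) (Finset.prod_ne_zero_iff.2 fun j _ => hne j), ih]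
    have hsum : residueHom 2 (wittClass B v) =
        padicValRat 2 (∏ i, (B (v i) (v i) : ℚ)) • cls (1 : ZMod 2) := by
      rw [hval, wittClass, map_sum, ← zmultiplesHom_apply, map_sum]
      exact Finset.sum_congr rfl fun i _ => by rw [residueHom, lift_cls, residue_two _ (hne i)]; rfl
    have hP0 : ∏ i, (B (v i) (v i) : ℚ) ≠ 0 := Finset.prod_ne_zero_iff.2 fun j _ => hne j
    have hc0 : (c : ℚ) ≠ 0 := by
      rintro h
      apply hP0
      have h0 : c = 0 := by exact_mod_cast h
      rw [h0] at hprod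
      have : ((∏ i, B (v i) (v i) : ℤ) : ℚ) = 0 := by rw [hprod]; simp
      simpa using this
    have hPq : ∏ i, (B (v i) (v i) : ℚ) = (u : ℚ) * (c : ℚ) ^ 2 := by
      have : ((∏ i, B (v i) (v i) : ℤ) : ℚ) = ((c ^ 2 * u : ℤ) : ℚ) := by rw [hprod]
      push_cast at this
      rw [this, mul_comm]
    rw [hsum, ← residue_two _ hP0, hPq, residue_mul_sq _ hc0]
    apply residue_of_padicValRat_eq_zero
    rcases Int.isUnit_iff.1 hunit with h | h <;> simp [h]
  · obtain ⟨w, hw, hwp⟩ := hu.exists_isOrthogonalFamily hs hp.out h2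
    rw [wittClass_eq hs hv hw, wittClass, map_sum]
    refine Finset.sum_eq_zero fun i _ => ?_
    rw [residueHom, lift_cls]
    apply residue_of_padicValRat_eq_zero
    rw [padicValRat.of_int, padicValInt.eq_zero_of_not_dvd (hwp i)]
    rfl

end Unimodular

end IntegralLattice

/-! ### Isotropic vectors in indefinite unimodular lattices -/

namespace IntegralLattice

open Module WittGroup DiagonalForm

variable {L : Type*} [AddCommGroup L] [Module.Free ℤ L] [Module.Finite ℤ L]
  {B : LinearMap.BilinForm ℤ L} {v : Fin (finrank ℤ L) → L}

theorem IsOrthogonalFamily.realForm_equivalent (hv : IsOrthogonalFamily B v) :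
    (realForm B).Equivalent
      (QuadraticMap.weightedSumSquares ℝ fun i => (B (v i) (v i) : ℝ)) := by
  set A : LinearMap.BilinForm ℝ (ℝ ⊗[ℤ] L) := LinearMap.BilinForm.baseChange ℝ B with hA
  have hAB : ∀ x y : L, A (1 ⊗ₜ x) (1 ⊗ₜ y) = B x y := by
    intro x y
    rw [hA, LinearMap.BilinForm.baseChange_tmul]
    simp
  let v' : Fin (finrank ℤ L) → ℝ ⊗[ℤ] L := fun i => 1 ⊗ₜ v i
  have hortho : ∀ i j, i ≠ j → A (v' i) (v' j) = 0 := fun i j hij => by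
    simp [v', hAB, hv.ortho i j hij]
  have hli : LinearIndependent ℝ v' := by
    refine LinearMap.BilinForm.linearIndependent_of_iIsOrtho (B := A) ?_ fun i => ?_
    · exact fun i j hij => hortho i j hij
    · simp [v', hAB, hv.ne_zero i]
  let b : Basis (Fin (finrank ℤ L)) ℝ (ℝ ⊗[ℤ] L) :=
    basisOfLinearIndependentOfCardEqFinrank' v' hli (by simp)
  have hb : ∀ i, b i = v' i := fun i => by simp [b]
  have hrepr : (realForm B).basisRepr b =
      QuadraticMap.weightedSumSquares ℝ fun i => (B (v i) (v i) : ℝ) := by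
    rw [QuadraticMap.basisRepr_eq_of_iIsOrtho]
    · congr 1
      ext i
      rw [hb]
      change A (v' i) (v' i) = _
      simp [v', hAB]
    · intro i j hij
      change QuadraticMap.associated (R := ℝ) (realForm B) (b i) (b j) = 0
      rw [hb, hb, realForm, QuadraticMap.associated_toQuadraticMap]
      change ⅟ (2 : ℝ) • (A (v' i) (v' j) + A (v' j) (v' i)) = 0
      rw [hortho i j hij, hortho j i hij.symm]
      simp
  rw [← hrepr]
  exact ⟨QuadraticMap.isometryEquivBasisRepr _ b⟩

/-- The signature and the rank of the lattice, read off from an orthogonal family. -/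
theorem IsOrthogonalFamily.signature_wittClass (hv : IsOrthogonalFamily B v) {p q : ℕ}
    (hB : HasSignature B p q) :
    signature (wittClass B v) = (p : ℤ) - q ∧ finrank ℤ L = p + q := by
  classical
  obtain ⟨hp, hq⟩ := hB
  rw [QuadraticForm.sigPos_of_equiv_weightedSumSquares hv.realForm_equivalent] at hp
  rw [QuadraticForm.sigNeg_of_equiv_weightedSumSquares hv.realForm_equivalent] at hq
  have hp' : (Finset.univ.filter fun i => 0 < B (v i) (v i)).card = p := by
    rw [← hp, ← Set.ncard_coe_finset]
    congr 1
    ext i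
    simp
  have hq' : (Finset.univ.filter fun i => ¬ 0 < B (v i) (v i)).card = q := by
    rw [← hq, ← Set.ncard_coe_finset]
    congr 1
    ext i
    have := hv.ne_zero i
    simp only [Finset.coe_filter, Finset.mem_univ, true_and, Set.mem_ofPred_eq,
      Int.cast_lt_zero]
    omega
  constructor
  · rw [wittClass, map_sum, ← Finset.sum_filter_add_sum_filter_not _ fun i => 0 < B (v i) (v i),
      ← hp', ← hq', sub_eq_add_neg]
    congr 1
    · rw [Finset.card_eq_sum_ones, Nat.cast_sum]
      refine Finset.sum_congr rfl fun i hi => ?_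
      have : (0 : ℚ) < B (v i) (v i) := by exact_mod_cast (Finset.mem_filter.1 hi).2
      simp [WittGroup.signature, this]
    · rw [Finset.card_eq_sum_ones, Nat.cast_sum, ← Finset.sum_neg_distrib]
      refine Finset.sum_congr rfl fun i hi => ?_
      have : (B (v i) (v i) : ℚ) < 0 := by
        have h1 := (Finset.mem_filter.1 hi).2
        have h2 := hv.ne_zero i
        exact_mod_cast lt_of_le_of_ne (not_lt.1 h1) h2
      simp [WittGroup.signature, this]
  · rw [← hp', ← hq', Finset.card_filter_add_card_filter_not]
    simp

omit [Module.Free ℤ L] [Module.Finite ℤ L] in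
theorem IsOrthogonalFamily.exists_isotropic_of_rat (hv : IsOrthogonalFamily B v)
    {x : Fin (finrank ℤ L) → ℚ} (hx : x ≠ 0)
    (h : ∑ i, (B (v i) (v i) : ℚ) * x i * x i = 0) : ∃ e : L, e ≠ 0 ∧ B e e = 0 := by
  obtain ⟨D, hD⟩ := IsLocalization.exist_integer_multiples_of_finite (nonZeroDivisors ℤ) x
  choose z hz using hD
  have hD0 : ((D : ℤ) : ℚ) ≠ 0 := by exact_mod_cast nonZeroDivisors.coe_ne_zero D
  have hz' : ∀ i, (z i : ℚ) = (D : ℤ) * x i := fun i => by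
    have := hz i
    simpa using this
  refine ⟨∑ i, z i • v i, fun h0 => ?_, ?_⟩
  · obtain ⟨i, hi⟩ := Function.ne_iff.1 hx
    have h1 := hv.apply_sum_smul z i
    rw [h0, map_zero, LinearMap.zero_apply] at h1
    have h2 : z i = 0 := by simpa [hv.ne_zero i] using h1.symm
    have h3 := hz' i
    rw [h2, Int.cast_zero] at h3
    exact hi (by simpa [hD0] using h3.symm)
  · have h1 : B (∑ i, z i • v i) (∑ i, z i • v i) = ∑ i, B (v i) (v i) * z i * z i := by
      conv_lhs => rw [map_sum (B (∑ i, z i • v i))]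
      exact Finset.sum_congr rfl fun i _ => by
        rw [map_smul, hv.apply_sum_smul, smul_eq_mul]; ring
    have h2 : ((∑ i, B (v i) (v i) * z i * z i : ℤ) : ℚ) =
        (D : ℤ) ^ 2 * ∑ i, (B (v i) (v i) : ℚ) * x i * x i := by
      push_cast
      rw [Finset.mul_sum]
      exact Finset.sum_congr rfl fun i _ => by rw [hz']; ring
    rw [h, mul_zero] at h2
    rw [h1]
    exact_mod_cast h2

/-- An indefinite unimodular lattice has a nonzero isotropic vector: its rational class is that of
`p - q` copies of `⟨1⟩`, so adding `|p - q|` weights `∓1` makes it metabolic. -/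
theorem IsUnimodular.exists_isotropic (hs : B.IsSymm) (hu : IsUnimodular B) {p q : ℕ}
    (hB : HasSignature B p q) (hp : 0 < p) (hq : 0 < q) : ∃ e : L, e ≠ 0 ∧ B e e = 0 := by
  obtain ⟨v, hv, -⟩ := hu.exists_isOrthogonalFamily hs Nat.prime_three (by norm_num)
  obtain ⟨hsig, hrank⟩ := hv.signature_wittClass hB
  have hcls := eq_signature_smul_cls_one (wittClass B v)
    fun p _ => hu.residueHom_wittClass hs hv p
  rw [hsig] at hcls
  obtain ⟨n, ε, hn, hε⟩ : ∃ (n : ℕ) (ε : ℚ), n < p + q ∧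
      wittClass B v + n • cls ε = 0 := by
    rcases le_total p q with hpq | hpq
    · refine ⟨q - p, 1, by omega, ?_⟩
      rw [hcls, ← natCast_zsmul, ← add_zsmul, Nat.cast_sub hpq]
      simp
    · refine ⟨p - q, -1, by omega, ?_⟩
      rw [hcls, cls_neg, ← natCast_zsmul, zsmul_neg, ← neg_zsmul, ← add_zsmul, Nat.cast_sub hpq]
      simp
  set a : Fin (finrank ℤ L) → ℚ := fun i => B (v i) (v i) with ha
  have hmet : MetabolicWeights
      (Finset.univ.val.map a + Finset.univ.val.map fun _ : Fin n => ε) := by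
    apply metabolicWeights_of_sum_cls_eq_zero
    rw [Multiset.map_add, Multiset.sum_add, ← hε, Multiset.map_map, Multiset.map_map]
    congr 1
    simp
  rw [← map_univ_sumElim, metabolicWeights_map_iff] at hmet
  obtain ⟨x, hx, hx0⟩ := hmet.exists_isotropic (by simpa [hrank] using hn)
  exact hv.exists_isotropic_of_rat hx hx0

/-! ### Primitive isotropic vectors fixed by a unipotent isometry -/

theorem exists_isPrimitiveVector_smul_eq {e : L} (he : e ≠ 0) :
    ∃ (n : ℤ) (x : L), n ≠ 0 ∧ IsPrimitiveVector x ∧ e = n • x := by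
  let b := Module.finBasis ℤ L
  induction h : ∑ i, (b.repr e i).natAbs using Nat.strong_induction_on generalizing e with
  | _ N ih =>
  by_cases hprim : IsPrimitiveVector e
  · exact ⟨1, e, one_ne_zero, hprim, by simp⟩
  simp only [IsPrimitiveVector, not_and, not_forall] at hprim
  obtain ⟨n, x, rfl, hn⟩ := hprim he
  have hn0 : n ≠ 0 := by rintro rfl; simp at he
  have hx0 : x ≠ 0 := by rintro rfl; simp at he
  have hlt : ∑ i, (b.repr x i).natAbs < N := by
    rw [← h]
    have hn1 : n.natAbs ≠ 1 := fun h1 => hn (Int.isUnit_iff_natAbs_eq.2 h1)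
    have hpos : ∃ i, b.repr x i ≠ 0 := by
      by_contra! hcon
      exact hx0 (b.repr.map_eq_zero_iff.1 (Finsupp.ext hcon))
    obtain ⟨i, hi⟩ := hpos
    have h2 : 2 ≤ n.natAbs := by omega
    refine Finset.sum_lt_sum (fun j _ => ?_) ⟨i, Finset.mem_univ i, ?_⟩
    · simp only [map_smul, Finsupp.smul_apply, smul_eq_mul, Int.natAbs_mul]
      exact Nat.le_mul_of_pos_left _ (by omega)
    · simp only [map_smul, Finsupp.smul_apply, smul_eq_mul, Int.natAbs_mul]
      have := Int.natAbs_pos.2 hi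
      nlinarith
  obtain ⟨m, y, hm, hy, rfl⟩ := ih _ hlt hx0 rfl
  exact ⟨n * m, y, mul_ne_zero hn0 hm, hy, by rw [mul_smul]⟩

omit [Module.Free ℤ L] [Module.Finite ℤ L] in
/-- A nontrivial unipotent isometry `U` fixes a nonzero isotropic vector: the image of the last
nonzero power of `U - 1` lies both in the kernel of `U - 1` and in its image, and these two are
orthogonal. -/
theorem exists_fixed_isotropic_of_ne_one {U : L ≃ₗ[ℤ] L} (hU : U ∈ orthogonalGroup B)
    (hunip : IsUnipotent U) (h1 : (U : Module.End ℤ L) - 1 ≠ 0) :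
    ∃ e : L, e ≠ 0 ∧ B e e = 0 ∧ U e = e := by
  classical
  set N : Module.End ℤ L := (U : Module.End ℤ L) - 1 with hN
  have hex : ∃ k, N ^ k = 0 := hunip
  have hmin : ∀ k < Nat.find hex, N ^ k ≠ 0 := fun k hk => Nat.find_min hex hk
  have hspec := Nat.find_spec hex
  obtain ⟨m, hm⟩ : ∃ m, Nat.find hex = m + 2 := by
    have h0 : Nat.find hex ≠ 0 := fun h => by
      rw [h, pow_zero] at hspec
      exact h1 (by rw [← one_mul N, hspec, zero_mul])
    have h1' : Nat.find hex ≠ 1 := fun h => by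
      rw [h, pow_one] at hspec
      exact h1 hspec
    exact ⟨Nat.find hex - 2, by omega⟩
  rw [hm] at hspec hmin
  obtain ⟨x, hx⟩ : ∃ x, (N ^ (m + 1)) x ≠ 0 := by
    by_contra! hcon
    exact hmin (m + 1) (by omega) (LinearMap.ext hcon)
  set e := (N ^ (m + 1)) x with he
  have hNU : ∀ y, N y = U y - y := fun y => rfl
  have hfix : U e = e := by
    have : N e = 0 := by
      rw [he, ← Module.End.mul_apply, ← pow_succ', hspec, LinearMap.zero_apply]
    rwa [hNU, sub_eq_zero] at this
  refine ⟨e, hx, ?_, hfix⟩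
  have hey : e = U ((N ^ m) x) - (N ^ m) x := by
    rw [← hNU, ← Module.End.mul_apply, ← pow_succ']
  have h2 : B (U ((N ^ m) x)) e = B ((N ^ m) x) e := by
    conv_lhs => rw [← hfix]
    exact hU _ _
  conv_lhs => rw [show B e = B (U ((N ^ m) x) - (N ^ m) x) by rw [← hey]]
  rw [map_sub, LinearMap.sub_apply, h2, sub_self]

end IntegralLattice

theorem mainTheorem11 (d : ℕ) (hd : 1 ≤ d)
    {L : Type*} [AddCommGroup L] [Module.Free ℤ L] [Module.Finite ℤ L]
    (B : LinearMap.BilinForm ℤ L) (hsymm : B.IsSymm)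
    (hunim : IntegralLattice.IsUnimodular B)
    (hsig : IntegralLattice.HasSignature B (2 * d - 1) (10 * d - 1))
    (U : L ≃ₗ[ℤ] L) (hU : U ∈ IntegralLattice.orthogonalGroup B)
    (hunip : IntegralLattice.IsUnipotent U) :
    ∃ e : L, IntegralLattice.IsPrimitiveVector e ∧ B e e = 0 ∧ U e = e := by
  obtain ⟨e, he, hee, hUe⟩ : ∃ e : L, e ≠ 0 ∧ B e e = 0 ∧ U e = e := by
    by_cases h1 : (U : Module.End ℤ L) - 1 = 0
    · obtain ⟨e, he, hee⟩ := hunim.exists_isotropic hsymm hsig (by omega) (by omega)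
      exact ⟨e, he, hee, sub_eq_zero.1 (LinearMap.congr_fun h1 e)⟩
    · exact IntegralLattice.exists_fixed_isotropic_of_ne_one hU hunip h1
  obtain ⟨n, x, hn, hx, rfl⟩ := IntegralLattice.exists_isPrimitiveVector_smul_eq he
  refine ⟨x, hx, by simpa [hn] using hee, ?_⟩
  rw [map_smul] at hUe
  exact smul_right_injective L hn hUe
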